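/- Let $G$ be a unicyclic graph (a connected simple graph with as many edges as vertices) on $n\ge 8$ vertices. Write $$\det(xI-Q(G))=\sum_{i=0}^n(-1)^i\varphi_i(G)\,x^{n-i},\qquad Q(G)=D(G)+A(G),$$ where $A(G)$ is the adjacency matrix and $D(G)$ the diagonal matrix of vertex degrees. Suppose that the cycle $C$ of $G$ has length $g\ge 5$ and that only pendent paths of length $1$ or $2$ are attached to $C$; that is, every vertex off $C$ lies on a path $av_1\cdots v_k$ with $k\in\{1,2\}$, $a\in C$, $d(a)\ge 3$, $d(v_k)=1$, and $d(v_1)=2$ if $k=2$. Let $u,v,w$ be distinct vertices of $C$ with $u\sim v$ and $v\sim w$, and suppose that there are pendent edges $uu'$, $vv'$, $ww'$ of $G$ (so $u',v',w'$ have degree $1$). Let $G'$ be the graph obtained from $G$ by deleting the edge $vw$, all edges $wx$ with $x\in N_G(w)\setminus\{v,w'\}$ and all edges $vx$ with $x\in N_G(v)\setminus\{u,w,v'\}$, and adding the edge $uw$ and all edges $ux$ with $x\in (N_G(w)\setminus\{v,w'\})\cup(N_G(v)\setminus\{u,w,v'\})$. Then $$\varphi_i(G)\ge\varphi_i(G'),\qquad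 i=0,1,\dots,n,$$ with equality if and only if $i\in\{0,1,n\}$, or $n=8$ and $i=7$. -/

import Mathlib

namespace SignlessUnicyclic

/-- A unicyclic graph: a connected (simple) graph with as many edges as vertices. -/
def IsUnicyclic {V : Type*} [Fintype V] (G : SimpleGraph V) : Prop :=
  G.Connected ∧ G.edgeSet.ncard = Fintype.card V

/-- The signless Laplacian matrix `Q(G) = D(G) + A(G)`. -/
def signlessLaplacian {V : Type*} [Fintype V] [DecidableEq V]
    (G : SimpleGraph V) [DecidableRel G.Adj] : Matrix V V ℤ :=
  G.degMatrix ℤ + G.adjMatrix ℤ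

open Classical in
/-- The signless Laplacian coefficient `φ_i(G)`, for `0 ≤ i ≤ n = |V|`, given by
`det (x I - Q(G)) = ∑ i, (-1) ^ i * φ_i * x ^ (n - i)`. -/
noncomputable def phi {V : Type*} [Fintype V] (G : SimpleGraph V) (i : ℕ) : ℤ :=
  (-1) ^ i * (signlessLaplacian G).charpoly.coeff (Fintype.card V - i)

/-- `p` is a pendent path `a v₁ ⋯ v_k` attached to `a`, with `k = p.length ≥ 1`: the vertex `a` has
degree at least `3`, the end `v_k` has degree `1`, and `v₁, …, v_{k-1}` have degree `2`. -/
def IsPendentPath {V : Type*} {G : SimpleGraph V} [G.LocallyFinite] {a b : V}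
    (p : G.Walk a b) : Prop :=
  p.IsPath ∧ 1 ≤ p.length ∧ 3 ≤ G.degree a ∧ G.degree b = 1 ∧
    ∀ x ∈ p.support, x ≠ a → x ≠ b → G.degree x = 2

/-- Only pendent paths of length `1` or `2` are attached to the cycle `c`: each vertex off the
cycle lies on such a path, attached to some vertex of the cycle. -/
def OnlyShortPendentPaths {V : Type*} {G : SimpleGraph V} [G.LocallyFinite] {r : V}
    (c : G.Walk r r) : Prop :=
  ∀ x, x ∉ c.support → ∃ a ∈ c.support, ∃ b, ∃ p : G.Walk a b,
    IsPendentPath p ∧ (p.length = 1 ∨ p.length = 2) ∧ x ∈ p.support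

/-- The pair `x x'` is a pendent edge attached to `x`. -/
def IsPendentEdgeAt {V : Type*} (G : SimpleGraph V) [G.LocallyFinite] (x x' : V) : Prop :=
  G.Adj x x' ∧ G.degree x' = 1

/-- The transformed graph: the edge `v w`, the edges from `w` to its neighbours other than
`v, w'`, and the edges from `v` to its neighbours other than `u, w, v'` are deleted; the edge `u w`
and edges from `u` to all these neighbours are added. -/
def shortenCycle {V : Type*} (G : SimpleGraph V) (u v w v' w' : V) : SimpleGraph V :=
  G.deleteEdges ({s(v, w)} ∪ (fun x => s(w, x)) '' (G.neighborSet w \ {v, w'}) ∪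
      (fun x => s(v, x)) '' (G.neighborSet v \ {u, w, v'})) ⊔
    SimpleGraph.fromEdgeSet ({s(u, w)} ∪ (fun x => s(u, x)) '' (G.neighborSet w \ {v, w'}) ∪
      (fun x => s(u, x)) '' (G.neighborSet v \ {u, w, v'}))

end SignlessUnicyclic

/-!
Let `y` and `z` be the other neighbours of `u` and `w` on the cycle, and let `F` be the forest left
of `G` when the edges `uv`, `vw`, `uy`, `wz`, `uu'`, `vv'`, `ww'` are removed. To obtain `G'`, one
moves the edges of `F` at `v` and `w` to `u` and adds `uv`, `uw`, `uy`, `uz`, `uu'`, `vv'`, `ww'`.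

Since `φ_i` is the coefficient of `x ^ (n - i)` in `det (x + Q)`, it suffices to compare these
determinants. Eliminating all vertices except the eight named ones turns both of them into the same
factor times an explicit determinant in the entries of a Schur complement of `F`, and most of these
entries vanish because `u`, `v`, `w` and `{y, z}` lie in different components of `F`. The difference
of the two determinants is then `x + 1` times a combination of minors of `F` whose weights are
polynomials in `x` with nonnegative coefficients. Each minor is the determinant of a positive
semidefinite Gram matrix with `x` added at some diagonal entries, so its coefficients are
nonnegative too. A minor has a positive coefficient at `x ^ k` when each component of `F` misses one
of `u`, `v`, `w`, `y`, `z` in the minor or one of the `k` vertices deleted for that coefficient;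
otherwise the signs of a 2-colouring of a component lie in the kernel.
-/

namespace SignlessUnicyclic
open Polynomial Matrix SimpleGraph

/-! ### Principal minors and nonnegative coefficients -/

/-- The semiring of real polynomials with nonnegative coefficients; it is used to compare
characteristic polynomials coefficient by coefficient. -/
def nonnegCoeffs : Subsemiring ℝ[X] where
  carrier := {f | ∀ i, 0 ≤ f.coeff i}
  zero_mem' _ := by simp
  one_mem' i := by rw [coeff_one]; positivity
  add_mem' hf hg i := by rw [coeff_add]; exact add_nonneg (hf i) (hg i)
  mul_mem' hf hg i := by
    rw [coeff_mul]; exact Finset.sum_nonneg fun p _ => mul_nonneg (hf p.1) (hg p.2)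

lemma C_mem_nonnegCoeffs {a : ℝ} (ha : 0 ≤ a) : C a ∈ nonnegCoeffs := fun i => by
  rw [coeff_C]; split_ifs <;> simp [ha]

lemma X_mem_nonnegCoeffs : (X : ℝ[X]) ∈ nonnegCoeffs := fun i => by
  rw [coeff_X]; positivity

lemma coeff_mul_pos {f g : ℝ[X]} (hf : f ∈ nonnegCoeffs) (hg : g ∈ nonnegCoeffs) {i j : ℕ}
    (hi : 0 < f.coeff i) (hj : 0 < g.coeff j) : 0 < (f * g).coeff (i + j) := by
  rw [coeff_mul]
  exact Finset.sum_pos' (fun p _ => mul_nonneg (hf p.1) (hg p.2))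
    ⟨(i, j), by simp, mul_pos hi hj⟩

section PrincipalMinors
variable {n R : Type*} [Fintype n] [DecidableEq n] [CommRing R]

lemma det_diagonal_add (d : n → R) (M : Matrix n n R) :
    (diagonal d + M).det =
      ∑ t : Finset n, (∏ i ∈ t, d i) * (M.submatrix ((↑) : ↥tᶜ → n) (↑)).det := by
  refine ((detRowAlternating (R := R)).map_add_univ (diagonal d) M).trans
    (Finset.sum_congr rfl fun t _ => ?_)
  have hrow : t.piecewise (diagonal d) M = fun i =>
      (if i ∈ t then d i else 1) • tᶜ.piecewise M.row (1 : Matrix n n R).row i := by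
    funext i j
    by_cases hi : i ∈ t <;> simp [Finset.piecewise, hi, diagonal_apply, one_apply]
  rw [hrow, AlternatingMap.map_smul_univ, ← det_piecewise_one_eq_submatrix_det, smul_eq_mul,
    Finset.prod_ite_mem, Finset.univ_inter]
  rfl

lemma det_diagonal_add_map_C (d : n → ℝ[X]) (M : Matrix n n ℝ) :
    (diagonal d + M.map C).det =
      ∑ t : Finset n, (∏ i ∈ t, d i) * C (M.submatrix ((↑) : ↥tᶜ → n) (↑)).det := by
  rw [det_diagonal_add]
  refine Finset.sum_congr rfl fun t _ => ?_
  rw [RingHom.map_det]; rfl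

variable {d : n → ℝ[X]} {M : Matrix n n ℝ}

lemma det_diagonal_add_mem_nonnegCoeffs (hd : ∀ i, d i ∈ nonnegCoeffs) (hM : M.PosSemidef) :
    (diagonal d + M.map C).det ∈ nonnegCoeffs := by
  rw [det_diagonal_add_map_C]
  exact sum_mem fun t _ => mul_mem (prod_mem fun i _ => hd i)
    (C_mem_nonnegCoeffs (hM.submatrix _).det_nonneg)

lemma coeff_det_diagonal_add_pos (hd : ∀ i, d i ∈ nonnegCoeffs) (hM : M.PosSemidef) {j : ℕ}
    (t : Finset n) (hdt : 0 < (∏ i ∈ t, d i).coeff j)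
    (hMt : 0 < (M.submatrix ((↑) : ↥tᶜ → n) (↑)).det) :
    0 < (diagonal d + M.map C).det.coeff j := by
  rw [det_diagonal_add_map_C, finsetSum_coeff]
  refine Finset.sum_pos' (fun s _ => ?_) ⟨t, Finset.mem_univ t, ?_⟩
  · exact mul_mem (prod_mem fun i _ => hd i) (C_mem_nonnegCoeffs (hM.submatrix _).det_nonneg) j
  · rw [coeff_mul_C]; exact mul_pos hdt hMt

lemma det_submatrix_compl_pos (hM : M.PosSemidef) (t : Finset n)
    (ht : ∀ x : n → ℝ, (∀ i ∈ t, x i = 0) → M *ᵥ x = 0 → x = 0) :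
    0 < (M.submatrix ((↑) : ↥tᶜ → n) (↑)).det := by
  refine (hM.submatrix _).det_nonneg.lt_of_ne' fun hdet => ?_
  rw [← det_piecewise_one_eq_submatrix_det] at hdet
  obtain ⟨x, hx, hrow⟩ := exists_mulVec_eq_zero_iff.mpr hdet
  have hxt : ∀ i ∈ t, x i = 0 := fun i hi => by
    have := congrFun hrow i
    simpa [mulVec, Finset.piecewise, hi, one_apply, dotProduct] using this
  have hMx : ∀ i ∉ t, (M *ᵥ x) i = 0 := fun i hi => by
    have := congrFun hrow i
    simpa [mulVec, Finset.piecewise, hi] using this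
  refine hx (ht x hxt ((hM.dotProduct_mulVec_zero_iff x).mp ?_))
  refine Finset.sum_eq_zero fun i _ => ?_
  by_cases hi : i ∈ t
  · simp [hxt i hi]
  · simp [hMx i hi]

lemma map_det_diagonal_add_eq_zero {S : Type*} [CommRing S] [IsDomain S] (f : ℝ[X] →+* S)
    {x : n → ℝ} (hx : x ≠ 0) (hMx : M *ᵥ x = 0) (hd : ∀ i, x i ≠ 0 → f (d i) = 0) :
    f (diagonal d + M.map C).det = 0 := by
  rw [RingHom.map_det]
  refine exists_mulVec_eq_zero_iff.mp ⟨fun i => f (C (x i)), fun h => hx ?_, ?_⟩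
  · funext i
    exact (f.comp C).injective ((congrFun h i).trans (map_zero _).symm)
  · funext i
    have hsum : ∑ j, M i j * x j = 0 := congrFun hMx i
    have hdi : f (d i) * f (C (x i)) = 0 := by
      by_cases hi : x i = 0
      · simp [hi]
      · simp [hd i hi]
    simp only [mulVec, dotProduct, RingHom.mapMatrix_apply, map_apply, Matrix.add_apply, map_add,
      add_mul, Finset.sum_add_distrib, diagonal_apply, apply_ite f, map_zero, ite_mul, zero_mul,
      Finset.sum_ite_eq, Finset.mem_univ, if_true, hdi, Pi.zero_apply, zero_add]
    simp only [← map_mul, ← map_sum, hsum, map_zero]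

end PrincipalMinors

lemma inv_apply_eq_zero_of_ne {n K α : Type*} [Fintype n] [DecidableEq n] [Field K]
    [LinearOrder α] {M : Matrix n n K} (hM : IsUnit M.det) {b : n → α}
    (hb : ∀ i j, b i ≠ b j → M i j = 0) {i j : n} (hij : b i ≠ b j) : M⁻¹ i j = 0 := by
  let _ := M.invertibleOfIsUnitDet hM
  rcases hij.lt_or_gt with h | h
  · exact blockTriangular_inv_of_blockTriangular (b := OrderDual.toDual ∘ b)
      (fun i j h => hb i j (ne_of_lt h)) h
  · exact blockTriangular_inv_of_blockTriangular (fun i j h => hb i j (ne_of_gt h)) h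

/-! ### Schur complements on ports -/

section Ports

lemma sumElim_zero_X_mem_nonnegCoeffs {m L : Type*} (p : m ⊕ L) :
    Sum.elim (0 : m → ℝ[X]) (fun _ => X) p ∈ nonnegCoeffs := by
  cases p
  exacts [zero_mem _, X_mem_nonnegCoeffs]

variable {ι L m : Type*} [DecidableEq L]

/-- The interior block of `A`, with `X` added on its diagonal, over the rational functions. -/
noncomputable def interiorMatrix (A : Matrix (ι ⊕ L) (ι ⊕ L) ℝ) : Matrix L L (RatFunc ℝ) :=
  diagonal (fun _ => RatFunc.X) + A.toBlocks₂₂.map RatFunc.C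

lemma isSymm_interiorMatrix {A : Matrix (ι ⊕ L) (ι ⊕ L) ℝ} (hA : A.IsSymm) :
    (interiorMatrix A).IsSymm := by
  ext i j
  simp [interiorMatrix, diagonal_apply, toBlocks₂₂, hA.apply (.inr i) (.inr j), eq_comm]

variable [Fintype L]

/-- The determinant on the interior, by which the determinants of all port matrices of `A` differ
from determinants on the ports. -/
noncomputable def interiorDet (A : Matrix (ι ⊕ L) (ι ⊕ L) ℝ) : ℝ[X] :=
  (diagonal (fun _ => X) + A.toBlocks₂₂.map C).det

lemma interiorDet_ne_zero (A : Matrix (ι ⊕ L) (ι ⊕ L) ℝ) : interiorDet A ≠ 0 := by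
  have h : interiorDet A = (-A.toBlocks₂₂).charpoly := by
    rw [interiorDet, charpoly, charmatrix, map_neg, sub_neg_eq_add]
    rfl
  rw [h]
  exact (charpoly_monic _).ne_zero

lemma det_interiorMatrix (A : Matrix (ι ⊕ L) (ι ⊕ L) ℝ) :
    (interiorMatrix A).det = algebraMap ℝ[X] (RatFunc ℝ) (interiorDet A) := by
  rw [interiorDet, RingHom.map_det]
  congr 1
  ext i j
  simp [interiorMatrix, diagonal_apply, apply_ite]

lemma isUnit_det_interiorMatrix (A : Matrix (ι ⊕ L) (ι ⊕ L) ℝ) :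
    IsUnit (interiorMatrix A).det := by
  rw [det_interiorMatrix, isUnit_iff_ne_zero]
  exact RatFunc.algebraMap_ne_zero (interiorDet_ne_zero A)

/-- The Schur complement on the ports of `A` with `X` added on the interior diagonal. -/
noncomputable def portSchur (A : Matrix (ι ⊕ L) (ι ⊕ L) ℝ) : Matrix ι ι (RatFunc ℝ) :=
  A.toBlocks₁₁.map RatFunc.C - A.toBlocks₁₂.map RatFunc.C * (interiorMatrix A)⁻¹ *
    A.toBlocks₂₁.map RatFunc.C

lemma isSymm_portSchur {A : Matrix (ι ⊕ L) (ι ⊕ L) ℝ} (hA : A.IsSymm) : (portSchur A).IsSymm := by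
  have h₁₁ : A.toBlocks₁₁ᵀ = A.toBlocks₁₁ := by ext; exact hA.apply _ _
  have h₁₂ : A.toBlocks₁₂ᵀ = A.toBlocks₂₁ := by ext; exact hA.apply _ _
  have h₂₁ : A.toBlocks₂₁ᵀ = A.toBlocks₁₂ := by ext; exact hA.apply _ _
  rw [Matrix.IsSymm, portSchur]
  simp only [transpose_sub, transpose_mul, transpose_nonsing_inv, ← transpose_map,
    (isSymm_interiorMatrix hA).eq, h₁₁, h₁₂, h₂₁, Matrix.mul_assoc]

section
variable {A : Matrix (ι ⊕ L) (ι ⊕ L) ℝ}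

lemma portSchur_apply_eq_zero_of_ne {α : Type*} [LinearOrder α] {b : ι ⊕ L → α}
    (hb : ∀ p q, b p ≠ b q → A p q = 0) {i j : ι} (hij : b (.inl i) ≠ b (.inl j)) :
    portSchur A i j = 0 := by
  have hinv {r s : L} (h : b (.inr r) ≠ b (.inr s)) : (interiorMatrix A)⁻¹ r s = 0 := by
    refine inv_apply_eq_zero_of_ne (b := b ∘ Sum.inr) (isUnit_det_interiorMatrix A)
      (fun r s h => ?_) h
    simp [interiorMatrix, toBlocks₂₂, hb _ _ h, diagonal_apply_ne _ (fun e => h (congrArg _ e))]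
  have hsum (r s : L) : A (.inl i) (.inr r) = 0 ∨ (interiorMatrix A)⁻¹ r s = 0 ∨
      A (.inr s) (.inl j) = 0 := by
    by_cases h1 : b (.inl i) = b (.inr r)
    · by_cases h2 : b (.inr s) = b (.inl j)
      · exact .inr (.inl (hinv fun h => hij (h1.trans (h.trans h2))))
      · exact .inr (.inr (hb _ _ h2))
    · exact .inl (hb _ _ h1)
  simp only [portSchur, Matrix.sub_apply, mul_apply, map_apply, toBlocks₁₁, toBlocks₁₂,
    toBlocks₂₁, of_apply, hb _ _ hij, map_zero, zero_sub, neg_eq_zero, Finset.sum_mul]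
  refine Finset.sum_eq_zero fun s _ => Finset.sum_eq_zero fun r _ => ?_
  rcases hsum r s with h | h | h <;> simp [h]

lemma portSchur_apply_eq_zero {i : ι} (hi : ∀ q, A (.inl i) q = 0) (j : ι) :
    portSchur A i j = 0 := by
  simp [portSchur, mul_apply, toBlocks₁₁, toBlocks₁₂, hi]

end

/-- The columns of `R` on the ports `ι`, followed by the identity on the interior `L`. -/
def portColumns (L : Type*) [DecidableEq L] (R : Matrix ι m ℝ) : Matrix (ι ⊕ L) (m ⊕ L) ℝ :=
  fromBlocks R 0 0 1

/-- The unit columns at the ports selected by `f`. -/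
def unitColumns {m ι : Type*} [DecidableEq ι] (f : m → ι) : Matrix ι m ℝ :=
  (1 : Matrix ι ι ℝ).submatrix id f

section
variable [Fintype m]

lemma portColumns_mulVec_inr (R : Matrix ι m ℝ) (x : m ⊕ L → ℝ) (r : L) :
    (portColumns L R *ᵥ x) (.inr r) = x (.inr r) := by
  simp [portColumns, fromBlocks_mulVec]

variable [DecidableEq ι]

lemma portColumns_unitColumns_mulVec_inl {f : m → ι} (hf : f.Injective)
    (x : m ⊕ L → ℝ) (i : m) :
    (portColumns L (unitColumns f) *ᵥ x) (.inl (f i)) = x (.inl i) := by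
  classical
  simp [portColumns, unitColumns, mulVec, dotProduct, one_apply, hf.eq_iff]

lemma portColumns_unitColumns_mulVec_of_notMem {f : m → ι} (x : m ⊕ L → ℝ) {p : ι}
    (hp : p ∉ Set.range f) :
    (portColumns L (unitColumns f) *ᵥ x) (.inl p) = 0 := by
  have hne (i : m) : p ≠ f i := fun h => hp ⟨i, h.symm⟩
  simp [portColumns, unitColumns, mulVec, dotProduct, one_apply, hne]

end

variable [Fintype ι]

/-- The compression of a matrix on `ι ⊕ L` along the columns of `R` on the ports `ι` and along the
identity on the interior `L`. -/
def portCompress (A : Matrix (ι ⊕ L) (ι ⊕ L) ℝ) (R : Matrix ι m ℝ) :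
    Matrix (m ⊕ L) (m ⊕ L) ℝ :=
  (portColumns L R)ᵀ * A * portColumns L R

/-- The compression of `A` along `R`, with the polynomial matrix `k` added on the ports and `X`
added on the interior diagonal. -/
noncomputable def portMatrix (A : Matrix (ι ⊕ L) (ι ⊕ L) ℝ) (R : Matrix ι m ℝ)
    (k : Matrix m m ℝ[X]) : Matrix (m ⊕ L) (m ⊕ L) ℝ[X] :=
  fromBlocks k 0 0 (diagonal fun _ => X) + (portCompress A R).map C

lemma portCompress_eq_fromBlocks (A : Matrix (ι ⊕ L) (ι ⊕ L) ℝ) (R : Matrix ι m ℝ) :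
    portCompress A R = fromBlocks (Rᵀ * A.toBlocks₁₁ * R) (Rᵀ * A.toBlocks₁₂)
      (A.toBlocks₂₁ * R) A.toBlocks₂₂ := by
  conv_lhs => rw [portCompress, portColumns, ← fromBlocks_toBlocks A]
  simp [fromBlocks_transpose, fromBlocks_multiply]

lemma posSemidef_portCompress [Finite m] {A : Matrix (ι ⊕ L) (ι ⊕ L) ℝ} (hA : A.PosSemidef)
    (R : Matrix ι m ℝ) :
    (portCompress A R).PosSemidef := by
  rw [portCompress, ← conjTranspose_eq_transpose_of_trivial]
  exact hA.conjTranspose_mul_mul_same _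

variable [Fintype m] [DecidableEq m]

theorem algebraMap_det_portMatrix (A : Matrix (ι ⊕ L) (ι ⊕ L) ℝ) (R : Matrix ι m ℝ)
    (k : Matrix m m ℝ[X]) :
    algebraMap ℝ[X] (RatFunc ℝ) (portMatrix A R k).det =
      algebraMap ℝ[X] (RatFunc ℝ) (interiorDet A) *
        (k.map (algebraMap ℝ[X] (RatFunc ℝ)) +
          (R.map RatFunc.C)ᵀ * portSchur A * R.map RatFunc.C).det := by
  let _ := (interiorMatrix A).invertibleOfIsUnitDet (isUnit_det_interiorMatrix A)
  have hblocks : (algebraMap ℝ[X] (RatFunc ℝ)).mapMatrix (portMatrix A R k) =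
      fromBlocks (k.map (algebraMap ℝ[X] (RatFunc ℝ)) +
          (R.map RatFunc.C)ᵀ * A.toBlocks₁₁.map RatFunc.C * R.map RatFunc.C)
        ((R.map RatFunc.C)ᵀ * A.toBlocks₁₂.map RatFunc.C)
        (A.toBlocks₂₁.map RatFunc.C * R.map RatFunc.C) (interiorMatrix A) := by
    have hC : algebraMap ℝ[X] (RatFunc ℝ) ∘ C = RatFunc.C := funext RatFunc.algebraMap_C
    rw [portMatrix, portCompress_eq_fromBlocks, fromBlocks_map, fromBlocks_add,
      RingHom.mapMatrix_apply, fromBlocks_map]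
    simp only [Matrix.map_add _ (map_add _), zero_add, Matrix.map_map, hC, Matrix.map_mul,
      transpose_map, interiorMatrix, diagonal_map (map_zero _), RatFunc.algebraMap_X]
  rw [RingHom.map_det, hblocks, det_fromBlocks₂₂, det_interiorMatrix, portSchur,
    invOf_eq_nonsing_inv]
  simp only [Matrix.mul_sub, Matrix.sub_mul, Matrix.mul_assoc, add_sub_assoc]

/-- The determinant of the compression of `A` along `R`, with `X` added on the interior diagonal.
Up to the factor `interiorDet A` it is the determinant of the compression of `portSchur A`. -/
noncomputable def portMinor (A : Matrix (ι ⊕ L) (ι ⊕ L) ℝ) (R : Matrix ι m ℝ) : ℝ[X] :=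
  (portMatrix A R 0).det

lemma portMinor_eq_det_diagonal_add (A : Matrix (ι ⊕ L) (ι ⊕ L) ℝ) (R : Matrix ι m ℝ) :
    portMinor A R = (diagonal (Sum.elim 0 fun _ => X) + (portCompress A R).map C).det := by
  rw [portMinor, portMatrix, ← diagonal_zero', fromBlocks_diagonal]

variable {A : Matrix (ι ⊕ L) (ι ⊕ L) ℝ} {R : Matrix ι m ℝ}

lemma portMinor_mem_nonnegCoeffs (hA : A.PosSemidef) (R : Matrix ι m ℝ) :
    portMinor A R ∈ nonnegCoeffs := by
  rw [portMinor_eq_det_diagonal_add]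
  exact det_diagonal_add_mem_nonnegCoeffs sumElim_zero_X_mem_nonnegCoeffs
    (posSemidef_portCompress hA R)

lemma coeff_portMinor_pos (hA : A.PosSemidef) (t : Finset L)
    (ht : ∀ x, (∀ r ∈ t, x (.inr r) = 0) → A *ᵥ (portColumns L R *ᵥ x) = 0 → x = 0) :
    0 < (portMinor A R).coeff t.card := by
  have hM := posSemidef_portCompress hA R
  rw [portMinor_eq_det_diagonal_add]
  refine coeff_det_diagonal_add_pos sumElim_zero_X_mem_nonnegCoeffs hM (t.map .inr) (by simp)
    (det_submatrix_compl_pos hM _ fun x hx hMx => ht x (by simpa using hx) ?_)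
  rw [← hA.dotProduct_mulVec_zero_iff, star_mulVec, ← dotProduct_mulVec,
    mulVec_mulVec, mulVec_mulVec, conjTranspose_eq_transpose_of_trivial]
  rw [← portCompress, hMx, dotProduct_zero]

lemma map_portMinor_eq_zero {S : Type*} [CommRing S] [IsDomain S] (f : ℝ[X] →+* S)
    {x : m ⊕ L → ℝ} (hx : x ≠ 0) (hAx : A *ᵥ (portColumns L R *ᵥ x) = 0)
    (hf : ∀ r, x (.inr r) ≠ 0 → f X = 0) : f (portMinor A R) = 0 := by
  rw [portMinor_eq_det_diagonal_add]
  refine map_det_diagonal_add_eq_zero f hx ?_ (Sum.rec (by simp) (by simpa using hf))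
  rw [portCompress, Matrix.mul_assoc, ← mulVec_mulVec, ← mulVec_mulVec, hAx, mulVec_zero]

section Selection
variable [DecidableEq ι] {f : m → ι}

lemma coeff_portMinor_unitColumns_pos (hA : A.PosSemidef) (hf : f.Injective) (t : Finset L)
    (ht : ∀ g : ι ⊕ L → ℝ, A *ᵥ g = 0 → (∀ p ∉ Set.range f, g (.inl p) = 0) →
      (∀ r ∈ t, g (.inr r) = 0) → g = 0) :
    0 < (portMinor A (unitColumns f)).coeff t.card := by
  refine coeff_portMinor_pos hA t fun x hx hAx => ?_
  have hg := ht _ hAx (fun p hp => portColumns_unitColumns_mulVec_of_notMem x hp)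
    fun r hr => (portColumns_mulVec_inr _ x r).trans (hx r hr)
  ext (i | r)
  · rw [← portColumns_unitColumns_mulVec_inl hf x i, hg]; rfl
  · rw [← portColumns_mulVec_inr (unitColumns f) x r, hg]; rfl

lemma map_portMinor_unitColumns_eq_zero {S : Type*} [CommRing S] [IsDomain S] (φ : ℝ[X] →+* S)
    (hf : f.Injective) {g : ι ⊕ L → ℝ} (hg : g ≠ 0) (hAg : A *ᵥ g = 0)
    (hgf : ∀ p ∉ Set.range f, g (.inl p) = 0) (hφ : ∀ r, g (.inr r) ≠ 0 → φ X = 0) :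
    φ (portMinor A (unitColumns f)) = 0 := by
  have hext : portColumns L (unitColumns f) *ᵥ (g ∘ Sum.map f id) = g := by
    ext (p | r)
    · by_cases hp : p ∈ Set.range f
      · obtain ⟨i, rfl⟩ := hp
        exact portColumns_unitColumns_mulVec_inl hf _ i
      · rw [portColumns_unitColumns_mulVec_of_notMem _ hp, hgf p hp]
    · exact portColumns_mulVec_inr _ _ r
  refine map_portMinor_eq_zero φ (fun h => hg ?_) (by rwa [hext]) hφ
  rw [← hext, h, mulVec_zero]

lemma algebraMap_portMinor_unitColumns (A : Matrix (ι ⊕ L) (ι ⊕ L) ℝ) (f : m → ι) :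
    algebraMap ℝ[X] (RatFunc ℝ) (portMinor A (unitColumns f)) =
      algebraMap ℝ[X] (RatFunc ℝ) (interiorDet A) * ((portSchur A).submatrix f f).det := by
  have hmap : (unitColumns f).map RatFunc.C =
      (1 : Matrix ι ι (RatFunc ℝ)).submatrix (Equiv.refl ι) f := by
    ext; simp [unitColumns, one_apply, apply_ite]
  rw [portMinor, algebraMap_det_portMatrix, hmap, transpose_submatrix, transpose_one,
    one_submatrix_mul, mul_submatrix_one, Matrix.map_zero _ (map_zero _), zero_add]
  rfl

end Selection
end Ports

/-! ### Gram matrices of edge sets -/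

section EdgeGram
variable {V W : Type*} [DecidableEq V] [DecidableEq W]

/-- The vector `e_a + e_b` of an edge `s(a, b)`: a column of the vertex-edge incidence matrix. -/
noncomputable def edgeVector : Sym2 V → V → ℝ :=
  Sym2.lift ⟨fun a b => Pi.single a 1 + Pi.single b 1, fun _ _ => add_comm _ _⟩

@[simp]
lemma edgeVector_mk (a b : V) : edgeVector s(a, b) = Pi.single a 1 + Pi.single b 1 := rfl

/-- The signless Laplacian of a set of edges, as the Gram matrix of its incidence matrix. -/
noncomputable def edgeGram (E : Finset (Sym2 V)) : Matrix V V ℝ :=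
  ∑ e ∈ E, vecMulVec (edgeVector e) (edgeVector e)

lemma posSemidef_edgeGram [Finite V] (E : Finset (Sym2 V)) : (edgeGram E).PosSemidef :=
  posSemidef_sum E fun e _ => by simpa using posSemidef_vecMulVec_self_star (edgeVector e)

lemma edgeGram_union {E E' : Finset (Sym2 V)} (h : Disjoint E E') :
    edgeGram (E ∪ E') = edgeGram E + edgeGram E' :=
  Finset.sum_union h

lemma edgeVector_map [Fintype V] (φ : V → W) (e : Sym2 V) :
    edgeVector (e.map φ) = ((1 : Matrix W W ℝ).submatrix φ id)ᵀ *ᵥ edgeVector e := by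
  induction e with | h a b =>
  ext x
  simp [mulVec_add, one_apply, Pi.single_apply]

lemma edgeGram_image [Fintype V] (φ : V → W) {E : Finset (Sym2 V)}
    (hφ : Set.InjOn (Sym2.map φ) E) : edgeGram (E.image (Sym2.map φ)) =
      ((1 : Matrix W W ℝ).submatrix φ id)ᵀ * edgeGram E * (1 : Matrix W W ℝ).submatrix φ id := by
  simp only [edgeGram, Finset.sum_image hφ, edgeVector_map, Matrix.mul_sum, Matrix.sum_mul,
    mul_vecMulVec, vecMulVec_mul, ← mulVec_transpose]

lemma edgeGram_image_inl [Finite V] (E : Finset (Sym2 V)) :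
    edgeGram (E.image (Sym2.map (Sum.inl : V → V ⊕ W))) = fromBlocks (edgeGram E) 0 0 0 := by
  have := Fintype.ofFinite V
  rw [edgeGram_image _ (Sym2.map.injective Sum.inl_injective).injOn]
  ext (a | a) (b | b) <;> simp [mul_apply, one_apply]

lemma edgeGram_edgeFinset [Fintype V] (G : SimpleGraph V) [DecidableRel G.Adj] :
    edgeGram G.edgeFinset = (signlessLaplacian G).map (Int.cast : ℤ → ℝ) := by
  have key : edgeGram G.edgeFinset = G.incMatrix ℝ * (G.incMatrix ℝ)ᵀ := by
    ext a b
    have h (e : Sym2 V) (he : e ∈ G.edgeSet) (x : V) : edgeVector e x = G.incMatrix ℝ x e := by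
      induction e with | h c d =>
      have hne : c ≠ d := he.ne
      by_cases hc : x = c <;> by_cases hd : x = d <;>
        simp_all [incMatrix_apply', incidenceSet]
    rw [edgeGram, Matrix.sum_apply, mul_apply]
    refine (Finset.sum_congr rfl fun e he => ?_).trans
      (Finset.sum_subset (Finset.subset_univ _) fun e _ he => ?_)
    · rw [mem_edgeFinset] at he
      rw [vecMulVec_apply, h e he, h e he, transpose_apply]
    · rw [mem_edgeFinset] at he
      simp [incMatrix_apply', incidenceSet, he]
  rw [key, incMatrix_mul_transpose]
  ext a b
  by_cases h : a = b <;> simp [h, signlessLaplacian, degMatrix, adjMatrix_apply]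

lemma edgeGram_mulVec_eq_zero_iff [Fintype V] {E : Finset (Sym2 V)} {g : V → ℝ} :
    edgeGram E *ᵥ g = 0 ↔ ∀ a b, s(a, b) ∈ E → g a + g b = 0 := by
  have hsum : edgeGram E *ᵥ g = ∑ e ∈ E, (edgeVector e ⬝ᵥ g) • edgeVector e := by
    simp [edgeGram, sum_mulVec, vecMulVec_mulVec]
  have hmk (a b : V) : edgeVector s(a, b) ⬝ᵥ g = g a + g b := by
    simp [add_dotProduct]
  constructor
  · intro h a b hab
    have hg : ∑ e ∈ E, (edgeVector e ⬝ᵥ g) ^ 2 = 0 := by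
      rw [hsum] at h
      simpa [sum_dotProduct, pow_two] using congrArg (· ⬝ᵥ g) h
    rw [← hmk]
    exact pow_eq_zero_iff two_ne_zero |>.mp
      ((Finset.sum_eq_zero_iff_of_nonneg fun _ _ => sq_nonneg _).mp hg _ hab)
  · intro h
    rw [hsum]
    refine Finset.sum_eq_zero fun e he => ?_
    induction e with | h a b =>
    rw [hmk, h a b he, zero_smul]

end EdgeGram

/-! ### The core determinants -/

/-- The core of the graph: the ports `inl 0, …, inl 4` stand for `u`, `v`, `w` and the other
neighbours `y` of `u` and `z` of `w` on the cycle; `inr 0, inr 1, inr 2` stand for `u'`, `v'`,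
`w'`. -/
abbrev Core : Type := Fin 5 ⊕ Fin 3

/-- The edges `uv, vw, uy, wz, uu', vv', ww'` of the original graph. -/
def coreEdges : Finset (Sym2 Core) :=
  {s(.inl 0, .inl 1), s(.inl 1, .inl 2), s(.inl 0, .inl 3), s(.inl 2, .inl 4),
    s(.inl 0, .inr 0), s(.inl 1, .inr 1), s(.inl 2, .inr 2)}

/-- The edges `uv, uw, uy, uz, uu', vv', ww'` of the transformed graph. -/
def foldedCoreEdges : Finset (Sym2 Core) :=
  {s(.inl 0, .inl 1), s(.inl 0, .inl 2), s(.inl 0, .inl 3), s(.inl 0, .inl 4),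
    s(.inl 0, .inr 0), s(.inl 1, .inr 1), s(.inl 2, .inr 2)}

lemma edgeGram_coreEdges : edgeGram coreEdges =
    fromBlocks !![3, 1, 0, 1, 0; 1, 3, 1, 0, 0; 0, 1, 3, 0, 1; 1, 0, 0, 1, 0; 0, 0, 1, 0, 1]
      !![1, 0, 0; 0, 1, 0; 0, 0, 1; 0, 0, 0; 0, 0, 0]
      !![1, 0, 0, 0, 0; 0, 1, 0, 0, 0; 0, 0, 1, 0, 0] 1 := by
  rw [edgeGram, coreEdges]
  simp (disch := decide) only [Finset.sum_insert, Finset.sum_singleton, edgeVector_mk]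
  ext (i | i) (j | j) <;> fin_cases i <;> fin_cases j <;>
    norm_num [vecMulVec_apply, Pi.single_apply, Fin.ext_iff, Sum.inl_ne_inr, Sum.inr_ne_inl]

lemma edgeGram_foldedCoreEdges : edgeGram foldedCoreEdges =
    fromBlocks !![5, 1, 1, 1, 1; 1, 2, 0, 0, 0; 1, 0, 2, 0, 0; 1, 0, 0, 1, 0; 1, 0, 0, 0, 1]
      !![1, 0, 0; 0, 1, 0; 0, 0, 1; 0, 0, 0; 0, 0, 0]
      !![1, 0, 0, 0, 0; 0, 1, 0, 0, 0; 0, 0, 1, 0, 0] 1 := by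
  rw [edgeGram, foldedCoreEdges]
  simp (disch := decide) only [Finset.sum_insert, Finset.sum_singleton, edgeVector_mk]
  ext (i | i) (j | j) <;> fin_cases i <;> fin_cases j <;>
    norm_num [vecMulVec_apply, Pi.single_apply, Fin.ext_iff, Sum.inl_ne_inr, Sum.inr_ne_inl]

/-- The map of ports that moves `v` and `w` to `u`. -/
def foldPort : Fin 5 → Fin 5 := ![0, 0, 0, 3, 4]

/-- The matrix of the pullback along `foldPort`. -/
noncomputable def foldColumns : Matrix Core Core ℝ :=
  (1 : Matrix Core Core ℝ).submatrix (Sum.map foldPort id) id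

/-- The coefficients of the principal minors in `openDet_sub_foldedDet`, read off from the expansion
of the difference in the entries of the Schur complement: the ports `0`, `1`, `2` select the row of
the table, and a factor attached to the port `3` or `4` drops out when that port is selected. -/
noncomputable def coreWeight (I : Finset (Fin 5)) : ℕ[X] :=
  let y (a : ℕ[X]) := if 3 ∈ I then 1 else a
  let z (a : ℕ[X]) := if 4 ∈ I then 1 else a
  let δ := y (X + 1) * z (X + 1)
  match decide (0 ∈ I), decide (1 ∈ I), decide (2 ∈ I) with
  | false, false, false =>
    if 3 ∈ I then
      if 4 ∈ I then (X + 1) * (3 * X ^ 2 + 8 * X + 2) else X ^ 2 * (2 * X ^ 2 + 6 * X + 3)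
    else
      if 4 ∈ I then X ^ 2 * (2 * X ^ 2 + 6 * X + 3)
      else X ^ 2 * (X + 1) * (3 * X ^ 2 + 10 * X + 6)
  | true, false, false =>
    (X + 1) * (X * (X + 2) * δ + (X ^ 2 + 4 * X + 2) * (y (X + 1) * z X))
  | false, false, true =>
    (X + 1) * (X * (X + 2) * δ + (X ^ 2 + 4 * X + 2) * (y X * z (X + 1)))
  | true, false, true => (X + 1) * (X ^ 2 + 4 * X + 2) * δ
  | false, true, false =>
    (X + 1) * ((2 * X ^ 2 + 7 * X + 3) * (y X * z X) +
      (X ^ 2 + 3 * X + 1) * (if 3 ∈ I then if 4 ∈ I then 0 else 1 else z (2 * X)))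
  | true, true, false =>
    (X + 1) * ((X ^ 2 + 3 * X + 1) * δ + (X + 1) * (y (X + 1) * z X))
  | false, true, true =>
    (X + 1) * ((X ^ 2 + 3 * X + 1) * δ + (X + 1) * (y X * z (X + 1)))
  | true, true, true => (X + 1) ^ 2 * δ

section CoreDeterminants
variable {R : Type*} [CommRing R]

set_option maxRecDepth 4000 in
lemma det_cyclicPorts (a b c d f t : R) :
    det !![a, 1, 0, 1, 0; 1, b, 1, 0, 0; 0, 1, c, 0, 1; 1, 0, 0, d, t; 0, 0, 1, t, f] =
      (d * f - t ^ 2) * (a * b * c - a - c) - d * (a * b - 1) - f * (b * c - 1) + 2 * t + b := by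
  simp [det_succ_row_zero, Fin.sum_univ_succ, Fin.succAbove]
  ring

set_option maxRecDepth 4000 in
lemma det_foldedPorts (a b c d f t : R) :
    det !![a, 1, 1, 1, 1; 1, b, 0, 0, 0; 1, 0, c, 0, 0; 1, 0, 0, d, t; 1, 0, 0, t, f] =
      b * c * (a * (d * f - t ^ 2) - (d + f - 2 * t)) - (b + c) * (d * f - t ^ 2) := by
  simp [det_succ_row_zero, Fin.sum_univ_succ, Fin.succAbove]
  ring

lemma det_separatedPorts (a b c d f t t' : R) :
    det !![a, 0, 0, 0, 0; 0, b, 0, 0, 0; 0, 0, c, 0, 0; 0, 0, 0, d, t; 0, 0, 0, t', f] =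
      a * b * c * (d * f - t * t') := by
  simp [det_succ_row_zero, Fin.sum_univ_succ, Fin.succAbove]
  ring

lemma det_submatrix_separatedPorts (a b c d f t : R) (I : Finset (Fin 5)) :
    ((!![a, 0, 0, 0, 0; 0, b, 0, 0, 0; 0, 0, c, 0, 0; 0, 0, 0, d, t; 0, 0, 0, t, f] :
      Matrix (Fin 5) (Fin 5) R).submatrix ((↑) : I → Fin 5) (↑)).det =
      (if 0 ∈ I then a else 1) * (if 1 ∈ I then b else 1) * (if 2 ∈ I then c else 1) *
        ((if 3 ∈ I then d else 1) * (if 4 ∈ I then f else 1) -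
          (if 3 ∈ I then t else 0) * (if 4 ∈ I then t else 0)) := by
  rw [← det_piecewise_one_eq_submatrix_det, ← det_separatedPorts]
  congr 1
  ext i j
  by_cases hi : i ∈ I
  · rw [of_apply, Finset.piecewise_eq_of_mem _ _ _ hi]
    fin_cases i <;> simp only [Fin.reduceFinMk, Fin.zero_eta, Fin.mk_one] at hi <;>
      fin_cases j <;> simp [hi, row]
  · rw [of_apply, Finset.piecewise_eq_of_notMem _ _ _ hi]
    fin_cases i <;> simp only [Fin.reduceFinMk, Fin.zero_eta, Fin.mk_one] at hi <;>
      fin_cases j <;> simp [hi, row]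

lemma det_fromBlocks_pendant {K : Type*} [Field K] (M : Matrix (Fin 5) (Fin 5) K) {s : K}
    (hs : s + 1 ≠ 0) :
    (fromBlocks M !![1, 0, 0; 0, 1, 0; 0, 0, 1; 0, 0, 0; 0, 0, 0]
      !![1, 0, 0, 0, 0; 0, 1, 0, 0, 0; 0, 0, 1, 0, 0] ((s + 1) • 1)).det =
      (s + 1) ^ 3 *
        (M - diagonal ![(s + 1)⁻¹, (s + 1)⁻¹, (s + 1)⁻¹, 0, 0]).det := by
  let _ : Invertible ((s + 1) • (1 : Matrix (Fin 3) (Fin 3) K)) :=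
    ⟨(s + 1)⁻¹ • 1, by simp [hs], by simp [hs]⟩
  rw [det_fromBlocks₂₂, det_smul, det_one, mul_one, Fintype.card_fin]
  congr 3
  change _ * ((s + 1)⁻¹ • 1) * _ = _
  ext i j
  fin_cases i <;> fin_cases j <;> simp [mul_apply, Fin.sum_univ_succ]

end CoreDeterminants

/-- The block form of a Schur complement on the core that is diagonal on the ports `u`, `v`, `w`,
couples only `y` with `z`, and vanishes on the pendent vertices. -/
def separatedSchur {R : Type*} [Zero R] (ρu ρv ρw η θ ζ : R) : Matrix Core Core R :=
  fromBlocks !![ρu, 0, 0, 0, 0; 0, ρv, 0, 0, 0; 0, 0, ρw, 0, 0; 0, 0, 0, η, θ; 0, 0, 0, θ, ζ] 0 0 0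

section
variable {L : Type*} [Fintype L] [DecidableEq L]

/-- The characteristic polynomial `det (X + Q)` of the graph formed by the edges with signless
Laplacian `A` and the core edges. -/
noncomputable def openDet (A : Matrix (Core ⊕ L) (Core ⊕ L) ℝ) : ℝ[X] :=
  (portMatrix A 1 ((X : ℝ[X]) • 1 + (edgeGram coreEdges).map C)).det

/-- The characteristic polynomial `det (X + Q)` of the graph formed by the edges with signless
Laplacian `A`, after `v` and `w` have been moved to `u`, and the folded core edges. -/
noncomputable def foldedDet (A : Matrix (Core ⊕ L) (Core ⊕ L) ℝ) : ℝ[X] :=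
  (portMatrix A foldColumns ((X : ℝ[X]) • 1 + (edgeGram foldedCoreEdges).map C)).det

variable {A : Matrix (Core ⊕ L) (Core ⊕ L) ℝ} {ρu ρv ρw η θ ζ : RatFunc ℝ}

lemma X_add_one_ne_zero : (RatFunc.X + 1 : RatFunc ℝ) ≠ 0 := by
  have h : (X + 1 : ℝ[X]) ≠ 0 := X_add_C_ne_zero 1
  simpa using RatFunc.algebraMap_ne_zero h

lemma algebraMap_openDet (hS : portSchur A = separatedSchur ρu ρv ρw η θ ζ) :
    algebraMap ℝ[X] (RatFunc ℝ) (openDet A) = algebraMap ℝ[X] (RatFunc ℝ) (interiorDet A) *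
      ((RatFunc.X + 1) ^ 3 *
      det !![RatFunc.X + 3 - (RatFunc.X + 1)⁻¹ + ρu, 1, 0, 1, 0;
        1, RatFunc.X + 3 - (RatFunc.X + 1)⁻¹ + ρv, 1, 0, 0;
        0, 1, RatFunc.X + 3 - (RatFunc.X + 1)⁻¹ + ρw, 0, 1;
        1, 0, 0, RatFunc.X + 1 + η, θ; 0, 0, 1, θ, RatFunc.X + 1 + ζ]) := by
  rw [openDet, algebraMap_det_portMatrix]
  congr 1
  trans (fromBlocks !![RatFunc.X + 3 + ρu, 1, 0, 1, 0; 1, RatFunc.X + 3 + ρv, 1, 0, 0;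
        0, 1, RatFunc.X + 3 + ρw, 0, 1; 1, 0, 0, RatFunc.X + 1 + η, θ;
        0, 0, 1, θ, RatFunc.X + 1 + ζ] !![1, 0, 0; 0, 1, 0; 0, 0, 1; 0, 0, 0; 0, 0, 0]
      !![1, 0, 0, 0, 0; 0, 1, 0, 0, 0; 0, 0, 1, 0, 0] ((RatFunc.X + 1 : RatFunc ℝ) • 1)).det
  · congr 1
    ext (i | i) (j | j) <;> fin_cases i <;> fin_cases j <;>
      simp [hS, separatedSchur, edgeGram_coreEdges, map_ofNat RatFunc.C]
  · rw [det_fromBlocks_pendant _ X_add_one_ne_zero]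
    congr 2
    ext i j
    fin_cases i <;> fin_cases j <;> simp <;> ring

lemma algebraMap_foldedDet (hS : portSchur A = separatedSchur ρu ρv ρw η θ ζ) :
    algebraMap ℝ[X] (RatFunc ℝ) (foldedDet A) = algebraMap ℝ[X] (RatFunc ℝ) (interiorDet A) *
      ((RatFunc.X + 1) ^ 3 *
      det !![RatFunc.X + 5 - (RatFunc.X + 1)⁻¹ + (ρu + ρv + ρw), 1, 1, 1, 1;
        1, RatFunc.X + 2 - (RatFunc.X + 1)⁻¹, 0, 0, 0;
        1, 0, RatFunc.X + 2 - (RatFunc.X + 1)⁻¹, 0, 0;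
        1, 0, 0, RatFunc.X + 1 + η, θ; 1, 0, 0, θ, RatFunc.X + 1 + ζ]) := by
  rw [foldedDet, algebraMap_det_portMatrix]
  congr 1
  trans (fromBlocks !![RatFunc.X + 5 + (ρu + ρv + ρw), 1, 1, 1, 1; 1, RatFunc.X + 2, 0, 0, 0;
        1, 0, RatFunc.X + 2, 0, 0; 1, 0, 0, RatFunc.X + 1 + η, θ;
        1, 0, 0, θ, RatFunc.X + 1 + ζ] !![1, 0, 0; 0, 1, 0; 0, 0, 1; 0, 0, 0; 0, 0, 0]
      !![1, 0, 0, 0, 0; 0, 1, 0, 0, 0; 0, 0, 1, 0, 0] ((RatFunc.X + 1 : RatFunc ℝ) • 1)).det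
  · have hfold : (foldColumns.map RatFunc.C)ᵀ * separatedSchur ρu ρv ρw η θ ζ *
        foldColumns.map RatFunc.C = separatedSchur (ρu + ρv + ρw) 0 0 η θ ζ := by
      ext (i | i) (j | j) <;> fin_cases i <;> fin_cases j <;>
        simp [mul_apply, foldColumns, separatedSchur, foldPort, Fin.sum_univ_succ, one_apply,
          apply_ite, add_assoc]
    rw [hS, hfold]
    congr 1
    ext (i | i) (j | j) <;> fin_cases i <;> fin_cases j <;>
      simp [separatedSchur, edgeGram_foldedCoreEdges, map_ofNat RatFunc.C]
  · rw [det_fromBlocks_pendant _ X_add_one_ne_zero]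
    congr 2
    ext i j
    fin_cases i <;> fin_cases j <;> simp
    all_goals ring

lemma algebraMap_portMinor_core (hS : portSchur A = separatedSchur ρu ρv ρw η θ ζ)
    (I : Finset (Fin 5)) :
    algebraMap ℝ[X] (RatFunc ℝ) (portMinor A (unitColumns fun i : I => Sum.inl i)) =
      algebraMap ℝ[X] (RatFunc ℝ) (interiorDet A) *
      ((if 0 ∈ I then ρu else 1) * (if 1 ∈ I then ρv else 1) * (if 2 ∈ I then ρw else 1) *
        ((if 3 ∈ I then η else 1) * (if 4 ∈ I then ζ else 1) -
          (if 3 ∈ I then θ else 0) * (if 4 ∈ I then θ else 0))) := by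
  rw [algebraMap_portMinor_unitColumns, hS, ← det_submatrix_separatedPorts]
  rfl

/-- The column `e_y - e_z`. -/
noncomputable def farColumn : Matrix Core (Fin 1) ℝ :=
  of fun p _ => Sum.elim ![0, 0, 0, 1, -1] 0 p

lemma algebraMap_portMinor_far (hS : portSchur A = separatedSchur ρu ρv ρw η θ ζ) :
    algebraMap ℝ[X] (RatFunc ℝ) (portMinor A farColumn) =
      algebraMap ℝ[X] (RatFunc ℝ) (interiorDet A) * (η - 2 * θ + ζ) := by
  rw [portMinor, algebraMap_det_portMatrix, hS]
  congr 1
  rw [det_unique]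
  simp [mul_apply, farColumn, separatedSchur, Fin.sum_univ_succ]
  ring

end

section
variable {L : Type*} [Fintype L] [DecidableEq L]
variable {A : Matrix (Core ⊕ L) (Core ⊕ L) ℝ} {ρu ρv ρw η θ ζ : RatFunc ℝ}

set_option maxHeartbeats 1000000 in
set_option maxRecDepth 20000 in
theorem openDet_sub_foldedDet (hS : portSchur A = separatedSchur ρu ρv ρw η θ ζ) :
    openDet A - foldedDet A = (X + 1) * (∑ I, (coreWeight I).map (Nat.castRingHom ℝ) *
        portMinor A (unitColumns fun i : I => Sum.inl i) +
      X * (X + 2) * (X ^ 2 + 4 * X + 2) * portMinor A farColumn) := by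
  apply RatFunc.algebraMap_injective ℝ
  rw [map_sub, algebraMap_openDet hS, algebraMap_foldedDet hS, det_cyclicPorts, det_foldedPorts]
  simp only [map_mul, map_add, map_sum, algebraMap_portMinor_core hS, algebraMap_portMinor_far hS]
  generalize algebraMap ℝ[X] (RatFunc ℝ) (interiorDet A) = D
  rw [show (Finset.univ : Finset (Finset (Fin 5))) =
    Finset.powerset (insert 0 (insert 1 (insert 2 (insert 3 (insert 4 ∅))))) from rfl]
  simp (disch := decide) only [Finset.sum_powerset_insert, Finset.powerset_empty,
    Finset.sum_singleton]
  simp only [RatFunc.algebraMap_X, map_one, coreWeight, Finset.notMem_empty, decide_false,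
    ↓reduceIte, Polynomial.map_mul, Polynomial.map_pow, map_X, Polynomial.map_add,
    Polynomial.map_one, Polynomial.map_ofNat, map_mul, map_pow, map_add,
    map_ofNat (algebraMap ℝ[X] (RatFunc ℝ)), mul_one, mul_zero, sub_zero, insert_empty_eq,
    Finset.mem_singleton, Fin.reduceEq, one_mul, zero_mul, Finset.mem_insert, or_self, or_false,
    or_true, decide_true, zero_ne_one, add_zero, one_ne_zero]
  have := X_add_one_ne_zero
  field_simp
  ring

end

/-! ### Signless Laplacian coefficients -/

section Phi

variable {V : Type*} [Fintype V]

lemma coeff_det_X_smul_one_add [DecidableEq V] (M : Matrix V V ℝ) {i : ℕ}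
    (hi : i ≤ Fintype.card V) :
    ((X : ℝ[X]) • 1 + M.map C).det.coeff (Fintype.card V - i) =
      (-1) ^ i * M.charpoly.coeff (Fintype.card V - i) := by
  have h : ((X : ℝ[X]) • 1 + M.map C).det = (-M).charpoly := by
    rw [charpoly, charmatrix, smul_one_eq_diagonal, scalar_apply]
    congr 1
    ext1 a b
    simp
  rw [h, charpoly_coeff_eq_sum_minors _ _ hi, charpoly_coeff_eq_sum_minors _ _ hi, ← mul_assoc,
    Finset.mul_sum, Finset.mul_sum]
  refine Finset.sum_congr rfl fun s hs => ?_
  rw [show (-M).submatrix Subtype.val Subtype.val =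
    -(M.submatrix (Subtype.val : s → V) Subtype.val) from rfl, det_neg, Fintype.card_coe,
    (Finset.mem_powersetCard.mp hs).2, mul_assoc]

lemma phi_eq_charpoly_coeff [DecidableEq V] (G : SimpleGraph V) [DecidableRel G.Adj] (i : ℕ) :
    phi G i = (-1) ^ i * (signlessLaplacian G).charpoly.coeff (Fintype.card V - i) := by
  rw [phi]
  congr!

lemma phi_eq_coeff_det [DecidableEq V] (G : SimpleGraph V) [DecidableRel G.Adj] {i : ℕ}
    (hi : i ≤ Fintype.card V) : (phi G i : ℝ) =
      ((X : ℝ[X]) • 1 + (edgeGram G.edgeFinset).map C).det.coeff (Fintype.card V - i) := by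
  rw [coeff_det_X_smul_one_add _ hi, edgeGram_edgeFinset, phi_eq_charpoly_coeff]
  change _ = (-1) ^ i * ((signlessLaplacian G).map (Int.castRingHom ℝ)).charpoly.coeff _
  rw [charpoly_map, Polynomial.coeff_map]
  simp

lemma phi_zero (G : SimpleGraph V) : phi G 0 = 1 := by
  classical
  have h := (charpoly_monic (signlessLaplacian G)).leadingCoeff
  rw [leadingCoeff, charpoly_natDegree_eq_dim] at h
  simpa [phi_eq_charpoly_coeff] using h

lemma phi_one [Nonempty V] (G : SimpleGraph V) [DecidableRel G.Adj] :
    phi G 1 = 2 * G.edgeFinset.card := by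
  classical
  rw [phi_eq_charpoly_coeff, pow_one, neg_one_mul, ← trace_eq_neg_charpoly_coeff,
    ← Nat.cast_ofNat, ← Nat.cast_mul, ← G.sum_degrees_eq_twice_card_edges]
  simp [signlessLaplacian, degMatrix]

lemma phi_comap {W : Type*} [Fintype W] (e : W ≃ V) (G : SimpleGraph V) (i : ℕ) :
    phi (G.comap e) i = phi G i := by
  classical
  have h : (signlessLaplacian G).reindex e.symm e.symm = signlessLaplacian (G.comap e) := by
    ext a b
    by_cases hab : a = b
    · subst hab
      simp only [signlessLaplacian, degMatrix, reindex_apply, submatrix_apply, Matrix.add_apply,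
        diagonal_apply_eq, adjMatrix_apply, SimpleGraph.irrefl, Equiv.symm_symm]
      congr 2
      convert (Iso.comap e G).degree_eq a
      rfl
    · simp [signlessLaplacian, degMatrix, adjMatrix_apply, hab]
  rw [phi_eq_charpoly_coeff, phi_eq_charpoly_coeff, ← h, charpoly_reindex, Fintype.card_congr e]

end Phi

/-! ### Core forests -/

section Kernel
variable {V : Type*} [Fintype V] [DecidableEq V] {F : SimpleGraph V} [DecidableRel F.Adj]

lemma edgeGram_edgeFinset_mulVec_eq_zero_iff {g : V → ℝ} :
    edgeGram F.edgeFinset *ᵥ g = 0 ↔ ∀ a b, F.Adj a b → g a + g b = 0 := by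
  simp only [edgeGram_mulVec_eq_zero_iff, mem_edgeFinset, mem_edgeSet]

lemma apply_eq_zero_of_reachable {g : V → ℝ} (hg : edgeGram F.edgeFinset *ᵥ g = 0) {a b : V}
    (hab : F.Reachable a b) (ha : g a = 0) : g b = 0 := by
  obtain ⟨p⟩ := hab
  induction p with
  | nil => exact ha
  | cons h _ ih =>
    refine ih ?_
    linarith [edgeGram_edgeFinset_mulVec_eq_zero_iff.mp hg _ _ h]

lemma exists_mulVec_eq_zero_of_isAcyclic (hF : F.IsAcyclic) (a : V) :
    ∃ g : V → ℝ, edgeGram F.edgeFinset *ᵥ g = 0 ∧ ∀ x, g x ≠ 0 ↔ F.Reachable a x := by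
  classical
  obtain ⟨c⟩ := hF.colorable_two
  refine ⟨fun x => if F.Reachable a x then if c x = 0 then 1 else -1 else 0,
    edgeGram_edgeFinset_mulVec_eq_zero_iff.mpr fun x y hxy => ?_, fun x => ?_⟩
  · have hreach : F.Reachable a x ↔ F.Reachable a y :=
      ⟨(·.trans hxy.reachable), (·.trans hxy.symm.reachable)⟩
    have hne := c.valid hxy
    by_cases hx : F.Reachable a x
    · rw [if_pos hx, if_pos (hreach.mp hx)]
      by_cases h : c x = 0
      · rw [if_pos h, if_neg (by omega), add_neg_cancel]
      · rw [if_neg h, if_pos (by omega), neg_add_cancel]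
    · rw [if_neg hx, if_neg (hreach.not.mp hx), add_zero]
  · by_cases hx : F.Reachable a x <;> by_cases h : c x = 0 <;> simp [hx, h]

end Kernel

section CoreForest
variable {L : Type*} {F : SimpleGraph (Core ⊕ L)}

/-- The component of the core forest that contains a given port. -/
def corePart : Fin 5 → Fin 4 := ![0, 1, 2, 3, 3]

/-- What remains of the graph when the core edges are removed: a forest with one component at each
of `u`, `v`, `w` and one that contains the rest of the cycle, from `y` to `z`. -/
structure IsCoreForest (F : SimpleGraph (Core ⊕ L)) : Prop where
  isAcyclic : F.IsAcyclic
  reachable_far : F.Reachable (.inl (.inl 3)) (.inl (.inl 4))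
  corePart_eq : ∀ {i j}, F.Reachable (.inl (.inl i)) (.inl (.inl j)) → corePart i = corePart j
  isIsolated : ∀ i, F.IsIsolated (.inl (.inr i))
  exists_reachable : ∀ r, ∃ i, F.Reachable (.inl (.inl i)) (.inr r)

lemma IsCoreForest.reachable_iff (hF : IsCoreForest F) {i j : Fin 5} :
    F.Reachable (.inl (.inl i)) (.inl (.inl j)) ↔ corePart i = corePart j := by
  refine ⟨hF.corePart_eq, ?_⟩
  fin_cases i <;> fin_cases j <;> simp [corePart, hF.reachable_far, hF.reachable_far.symm]

lemma IsCoreForest.not_reachable_pendant (hF : IsCoreForest F) (i : Fin 5) (k : Fin 3) :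
    ¬F.Reachable (.inl (.inl i)) (.inl (.inr k)) :=
  not_reachable_of_neighborSet_right_eq_empty (by simp) (hF.isIsolated k).neighborSet_eq_empty

variable [Fintype L] [DecidableEq L] [DecidableRel F.Adj]

/-- The principal port minor of a core forest at a set of ports. -/
noncomputable def coreMinor (F : SimpleGraph (Core ⊕ L)) [DecidableRel F.Adj]
    (I : Finset (Fin 5)) : ℝ[X] :=
  portMinor (edgeGram F.edgeFinset) (unitColumns fun i : I => Sum.inl i)

lemma coreMinor_mem_nonnegCoeffs (I : Finset (Fin 5)) : coreMinor F I ∈ nonnegCoeffs :=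
  portMinor_mem_nonnegCoeffs (posSemidef_edgeGram _) _

lemma injective_inl_val (I : Finset (Fin 5)) :
    (fun i : I => (Sum.inl i : Core)).Injective :=
  Sum.inl_injective.comp Subtype.val_injective

lemma IsCoreForest.coeff_coreMinor_pos (hF : IsCoreForest F) {I : Finset (Fin 5)} {t : Finset L}
    (h : ∀ i ∈ I, (∃ j ∉ I, corePart i = corePart j) ∨
      ∃ r ∈ t, F.Reachable (.inl (.inl i)) (.inr r)) :
    0 < (coreMinor F I).coeff t.card := by
  refine coeff_portMinor_unitColumns_pos (posSemidef_edgeGram _) (injective_inl_val I) t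
    fun g hg hports ht => ?_
  have hout (j : Fin 5) (hj : j ∉ I) : g (.inl (.inl j)) = 0 := hports _ (by simpa using hj)
  have hport (i : Fin 5) : g (.inl (.inl i)) = 0 := by
    by_cases hi : i ∈ I
    · obtain ⟨j, hj, hij⟩ | ⟨r, hr, hir⟩ := h i hi
      · exact apply_eq_zero_of_reachable hg (hF.reachable_iff.mpr hij.symm) (hout j hj)
      · exact apply_eq_zero_of_reachable hg hir.symm (ht r hr)
    · exact hout i hi
  ext ((i | k) | r)
  · exact hport i
  · exact hports _ (by simp)
  · obtain ⟨i, hi⟩ := hF.exists_reachable r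
    exact apply_eq_zero_of_reachable hg hi (hport i)

lemma IsCoreForest.map_coreMinor_eq_zero {S : Type*} [CommRing S] [IsDomain S] (hF : IsCoreForest F)
    (φ : ℝ[X] →+* S) (hφ : L → φ X = 0) {I : Finset (Fin 5)} (i : Fin 5)
    (h : ∀ j, corePart i = corePart j → j ∈ I) : φ (coreMinor F I) = 0 := by
  obtain ⟨g, hg, hgi⟩ := exists_mulVec_eq_zero_of_isAcyclic hF.isAcyclic (.inl (.inl i))
  refine map_portMinor_unitColumns_eq_zero φ (injective_inl_val I)
    (fun h0 => (hgi _).mpr .rfl (congrFun h0 _)) hg ?_ (fun r _ => hφ r)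
  rintro (j | k) hp
  · by_contra hne
    exact hp ⟨⟨j, h j (hF.corePart_eq ((hgi _).mp hne))⟩, rfl⟩
  · by_contra hne
    exact hF.not_reachable_pendant i k ((hgi _).mp hne)

lemma IsCoreForest.portMinor_farColumn_eq_zero (hF : IsCoreForest F) [IsEmpty L] :
    portMinor (edgeGram F.edgeFinset) farColumn = 0 := by
  refine map_portMinor_eq_zero (RingHom.id _) (x := Sum.elim 1 0) (fun h => ?_) ?_ isEmptyElim
  · simpa using congrFun h (.inl 0)
  · have hx : portColumns L farColumn *ᵥ Sum.elim 1 0 =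
        Sum.elim (Sum.elim ![0, 0, 0, 1, -1] 0) isEmptyElim := by
      ext (p | r)
      · simp [portColumns, mulVec, dotProduct, farColumn]
      · exact isEmptyElim r
    rw [hx, edgeGram_edgeFinset_mulVec_eq_zero_iff]
    rintro ((i | k) | r) ((j | l) | s) hadj
    · have hij := hF.corePart_eq hadj.reachable
      have hne : i ≠ j := by rintro rfl; exact hadj.ne rfl
      fin_cases i <;> fin_cases j <;> simp_all [corePart]
    · exact (hF.isIsolated l _ hadj.symm).elim
    · exact isEmptyElim s
    · exact (hF.isIsolated k _ hadj).elim
    · simp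
    · exact isEmptyElim s
    all_goals exact isEmptyElim r

end CoreForest

lemma map_natCast_mem_nonnegCoeffs (p : ℕ[X]) : p.map (Nat.castRingHom ℝ) ∈ nonnegCoeffs :=
  fun i => by rw [coeff_map]; exact Nat.cast_nonneg _

lemma X_sq_dvd_coreWeight {I : Finset (Fin 5)} (h0 : 0 ∉ I) (h1 : 1 ∉ I) (h2 : 2 ∉ I)
    (h : 3 ∉ I ∨ 4 ∉ I) : X ^ 2 ∣ coreWeight I := by
  by_cases h3 : 3 ∈ I <;> by_cases h4 : 4 ∈ I
  · simp_all
  all_goals simp [coreWeight, h0, h1, h2, h3, h4, mul_assoc]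

lemma coeff_coreWeight_empty_pos {i : ℕ} (h2 : 2 ≤ i) (h5 : i ≤ 5) :
    0 < (coreWeight ∅).coeff i := by
  have h : coreWeight ∅ = 3 * X ^ 5 + 13 * X ^ 4 + 16 * X ^ 3 + 6 * X ^ 2 := by
    simp [coreWeight]
    ring
  rw [h]
  interval_cases i <;> norm_num [coeff_X_pow, ← map_ofNat C]

/-- For each port a set of ports that contains all ports of its component in the core forest and of
no other component, chosen such that the weight of the set has a nonzero constant term. -/
def witnessPorts : Fin 5 → Finset (Fin 5) := ![{0, 4}, {1, 3}, {2, 3}, {3, 4}, {3, 4}]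

lemma coeff_zero_coreWeight_witnessPorts_pos (i : Fin 5) :
    0 < (coreWeight (witnessPorts i)).coeff 0 := by
  fin_cases i <;> simp [witnessPorts, coreWeight, coeff_zero_eq_eval_zero]

lemma exists_notMem_or_corePart_eq : ∀ i, ∀ k ∈ witnessPorts i,
    (∃ j ∉ witnessPorts i, corePart k = corePart j) ∨ corePart i = corePart k := by
  decide

lemma edgeGram_edgeFinset_apply_eq_zero {V : Type*} [Fintype V] [DecidableEq V]
    {F : SimpleGraph V} [DecidableRel F.Adj] {a b : V} (hab : a ≠ b) (h : ¬F.Adj a b) :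
    edgeGram F.edgeFinset a b = 0 := by
  simp [edgeGram_edgeFinset, signlessLaplacian, degMatrix, hab, h]

lemma edgeGram_edgeFinset_apply_eq_zero_of_isIsolated {V : Type*} [Fintype V] [DecidableEq V]
    {F : SimpleGraph V} [DecidableRel F.Adj] {a : V} (h : F.IsIsolated a) (b : V) :
    edgeGram F.edgeFinset a b = 0 := by
  have h0 : F.degree a = 0 := (degree_eq_zero F a).mpr h
  by_cases hab : a = b
  · subst hab
    simp [edgeGram_edgeFinset, signlessLaplacian, degMatrix, h0]
  · exact edgeGram_edgeFinset_apply_eq_zero hab (h b)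

section
variable {L : Type*} [Fintype L] [DecidableEq L] {F : SimpleGraph (Core ⊕ L)} [DecidableRel F.Adj]

lemma IsCoreForest.exists_portSchur_eq (hF : IsCoreForest F) :
    ∃ ρu ρv ρw η θ ζ, portSchur (edgeGram F.edgeFinset) = separatedSchur ρu ρv ρw η θ ζ := by
  set A := edgeGram F.edgeFinset
  have hA : A.IsSymm := by
    rw [IsSymm, ← conjTranspose_eq_transpose_of_trivial]
    exact (posSemidef_edgeGram _).isHermitian
  have hport {i j : Fin 5} (hij : corePart i ≠ corePart j) :
      portSchur A (.inl i) (.inl j) = 0 := by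
    refine portSchur_apply_eq_zero_of_ne (b := fun x => F.Reachable (.inl (.inl i)) x)
      (fun p q hpq => edgeGram_edgeFinset_apply_eq_zero (mt (congrArg _) hpq) fun h => hpq ?_) ?_
    · exact propext ⟨(·.trans h.reachable), (·.trans h.symm.reachable)⟩
    · exact fun h => hij (hF.corePart_eq (h ▸ Reachable.rfl))
  have hpendant (k : Fin 3) (p : Core) : portSchur A (.inr k) p = 0 :=
    portSchur_apply_eq_zero (edgeGram_edgeFinset_apply_eq_zero_of_isIsolated (hF.isIsolated k)) p
  refine ⟨portSchur A (.inl 0) (.inl 0), portSchur A (.inl 1) (.inl 1),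
    portSchur A (.inl 2) (.inl 2), portSchur A (.inl 3) (.inl 3), portSchur A (.inl 3) (.inl 4),
    portSchur A (.inl 4) (.inl 4), ?_⟩
  ext (i | k) (j | l)
  · by_cases hij : corePart i = corePart j
    · have hfar := (isSymm_portSchur hA).apply (.inl 3) (.inl 4)
      fin_cases i <;> fin_cases j <;> simp_all [corePart, separatedSchur]
    · rw [hport hij]
      fin_cases i <;> fin_cases j <;> simp_all [corePart, separatedSchur]
  · rw [← (isSymm_portSchur hA).apply, hpendant]
    rfl
  · exact hpendant k _
  · exact hpendant k _

/-- The quotient of the difference of `openDet` and `foldedDet` by `X + 1`. -/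
noncomputable def minorSum (F : SimpleGraph (Core ⊕ L)) [DecidableRel F.Adj] : ℝ[X] :=
  ∑ I, (coreWeight I).map (Nat.castRingHom ℝ) * coreMinor F I +
    X * (X + 2) * (X ^ 2 + 4 * X + 2) * portMinor (edgeGram F.edgeFinset) farColumn

lemma farWeight_mem_nonnegCoeffs :
    (X * (X + 2) * (X ^ 2 + 4 * X + 2) : ℝ[X]) ∈ nonnegCoeffs := by
  convert map_natCast_mem_nonnegCoeffs (X * (X + 2) * (X ^ 2 + 4 * X + 2))
  simp only [Polynomial.map_mul, Polynomial.map_add, Polynomial.map_pow, Polynomial.map_X,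
    Polynomial.map_ofNat]

lemma minorSum_mem_nonnegCoeffs : minorSum F ∈ nonnegCoeffs :=
  add_mem (sum_mem fun I _ => mul_mem (map_natCast_mem_nonnegCoeffs _)
    (coreMinor_mem_nonnegCoeffs I))
    (mul_mem farWeight_mem_nonnegCoeffs (portMinor_mem_nonnegCoeffs (posSemidef_edgeGram _) _))

lemma coeff_minorSum_pos {I : Finset (Fin 5)} {a b : ℕ} (ha : 0 < (coreWeight I).coeff a)
    (hb : 0 < (coreMinor F I).coeff b) : 0 < (minorSum F).coeff (a + b) := by
  have hterm (J : Finset (Fin 5)) :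
      (coreWeight J).map (Nat.castRingHom ℝ) * coreMinor F J ∈ nonnegCoeffs :=
    mul_mem (map_natCast_mem_nonnegCoeffs _) (coreMinor_mem_nonnegCoeffs J)
  rw [minorSum, coeff_add, finsetSum_coeff]
  refine add_pos_of_pos_of_nonneg
    (Finset.sum_pos' (fun J _ => hterm J _) ⟨I, Finset.mem_univ _, ?_⟩)
    (mul_mem farWeight_mem_nonnegCoeffs (portMinor_mem_nonnegCoeffs (posSemidef_edgeGram _) _) _)
  exact coeff_mul_pos (map_natCast_mem_nonnegCoeffs _) (coreMinor_mem_nonnegCoeffs I)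
    (by rw [coeff_map]; exact Nat.cast_pos.mpr ha) hb

lemma IsCoreForest.map_coreMinor_eq_zero_or_X_sq_dvd {S : Type*} [CommRing S] [IsDomain S]
    (hF : IsCoreForest F) (φ : ℝ[X] →+* S) (hφ : L → φ X = 0) (I : Finset (Fin 5)) :
    φ (coreMinor F I) = 0 ∨ X ^ 2 ∣ coreWeight I := by
  by_cases h : ∃ i, ∀ j, corePart i = corePart j → j ∈ I
  · obtain ⟨i, hi⟩ := h
    exact .inl (hF.map_coreMinor_eq_zero φ hφ i hi)
  · push Not at h
    refine .inr (X_sq_dvd_coreWeight ?_ ?_ ?_ ?_)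
    · simpa [corePart, Fin.exists_fin_succ] using h 0
    · simpa [corePart, Fin.exists_fin_succ] using h 1
    · simpa [corePart, Fin.exists_fin_succ] using h 2
    · simpa [corePart, Fin.exists_fin_succ] using h 3

lemma IsCoreForest.coeff_zero_minorSum (hF : IsCoreForest F) : (minorSum F).coeff 0 = 0 := by
  change constantCoeff (minorSum F) = 0
  rw [minorSum, map_add, map_sum, Finset.sum_eq_zero, zero_add]
  · simp
  · rintro I -
    obtain h | ⟨q, hq⟩ := hF.map_coreMinor_eq_zero_or_X_sq_dvd constantCoeff (by simp) I
    · rw [map_mul, h, mul_zero]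
    · simp [hq]

lemma IsCoreForest.X_sq_dvd_minorSum (hF : IsCoreForest F) [IsEmpty L] : X ^ 2 ∣ minorSum F := by
  rw [minorSum, hF.portMinor_farColumn_eq_zero, mul_zero, add_zero]
  refine Finset.dvd_sum fun I _ => ?_
  obtain h | h := hF.map_coreMinor_eq_zero_or_X_sq_dvd (RingHom.id _) isEmptyElim I
  · rw [RingHom.id_apply] at h
    rw [h, mul_zero]
    exact dvd_zero _
  · simpa using (Polynomial.map_dvd (Nat.castRingHom ℝ) h).mul_right (coreMinor F I)

theorem IsCoreForest.openDet_sub_foldedDet_eq (hF : IsCoreForest F) :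
    openDet (edgeGram F.edgeFinset) - foldedDet (edgeGram F.edgeFinset) =
      (X + 1) * minorSum F := by
  obtain ⟨ρu, ρv, ρw, η, θ, ζ, hS⟩ := hF.exists_portSchur_eq
  exact openDet_sub_foldedDet hS

lemma X_add_one_mem_nonnegCoeffs : (X + 1 : ℝ[X]) ∈ nonnegCoeffs :=
  add_mem X_mem_nonnegCoeffs (one_mem _)

lemma IsCoreForest.coeff_foldedDet_le (hF : IsCoreForest F) (j : ℕ) :
    (foldedDet (edgeGram F.edgeFinset)).coeff j ≤ (openDet (edgeGram F.edgeFinset)).coeff j := by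
  have h := mul_mem X_add_one_mem_nonnegCoeffs (minorSum_mem_nonnegCoeffs (F := F)) j
  rwa [← hF.openDet_sub_foldedDet_eq, coeff_sub, sub_nonneg] at h

lemma IsCoreForest.coeff_foldedDet_lt (hF : IsCoreForest F) {I : Finset (Fin 5)} {a b c : ℕ}
    (ha : 0 < (coreWeight I).coeff a) (hb : 0 < (coreMinor F I).coeff b) (hc : c ≤ 1) :
    (foldedDet (edgeGram F.edgeFinset)).coeff (c + (a + b)) <
      (openDet (edgeGram F.edgeFinset)).coeff (c + (a + b)) := by
  have h : 0 < ((X + 1) * minorSum F).coeff (c + (a + b)) := by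
    refine coeff_mul_pos X_add_one_mem_nonnegCoeffs minorSum_mem_nonnegCoeffs ?_
      (coeff_minorSum_pos ha hb)
    interval_cases c <;> simp [coeff_one]
  rwa [← hF.openDet_sub_foldedDet_eq, coeff_sub, sub_pos] at h

lemma IsCoreForest.coeff_foldedDet_lt_of_two_le (hF : IsCoreForest F) {j : ℕ} (h2 : 2 ≤ j)
    (hj : j ≤ Fintype.card L + 6) : (foldedDet (edgeGram F.edgeFinset)).coeff j <
      (openDet (edgeGram F.edgeFinset)).coeff j := by
  obtain ⟨t, -, ht⟩ := Finset.exists_subset_card_eq (s := (Finset.univ : Finset L))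
    (n := min (j - 2) (Fintype.card L)) (by simp)
  have hb : 0 < (coreMinor F ∅).coeff t.card := hF.coeff_coreMinor_pos (by simp)
  obtain ⟨a, c, ha2, ha5, hc, rfl⟩ : ∃ a c, 2 ≤ a ∧ a ≤ 5 ∧ c ≤ 1 ∧ j = c + (a + t.card) :=
    ⟨min 5 (j - t.card), j - t.card - min 5 (j - t.card), by omega, by omega, by omega, by omega⟩
  exact hF.coeff_foldedDet_lt (coeff_coreWeight_empty_pos ha2 ha5) hb hc

lemma IsCoreForest.coeff_one_foldedDet_lt [Nonempty L] (hF : IsCoreForest F) :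
    (foldedDet (edgeGram F.edgeFinset)).coeff 1 < (openDet (edgeGram F.edgeFinset)).coeff 1 := by
  obtain ⟨r⟩ := ‹Nonempty L›
  obtain ⟨i, hi⟩ := hF.exists_reachable r
  have hb : 0 < (coreMinor F (witnessPorts i)).coeff ({r} : Finset L).card := by
    refine hF.coeff_coreMinor_pos fun k hk => ?_
    refine (exists_notMem_or_corePart_eq i k hk).imp_right fun h => ⟨r, by simp, ?_⟩
    exact (hF.reachable_iff.mpr h).symm.trans hi
  exact hF.coeff_foldedDet_lt (coeff_zero_coreWeight_witnessPorts_pos i) hb (c := 0) zero_le_one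

lemma IsCoreForest.coeff_foldedDet_eq (hF : IsCoreForest F) {j : ℕ}
    (hj : j = 0 ∨ j = 1 ∧ IsEmpty L) : (foldedDet (edgeGram F.edgeFinset)).coeff j =
      (openDet (edgeGram F.edgeFinset)).coeff j := by
  refine (sub_eq_zero.mp ?_).symm
  rw [← coeff_sub, hF.openDet_sub_foldedDet_eq]
  obtain rfl | ⟨rfl, hL⟩ := hj
  · rw [mul_coeff_zero, hF.coeff_zero_minorSum, mul_zero]
  · exact X_pow_dvd_iff.mp (hF.X_sq_dvd_minorSum.mul_left _) 1 one_lt_two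

theorem IsCoreForest.coeff_foldedDet_eq_iff (hF : IsCoreForest F) {j : ℕ}
    (hj : j ≤ Fintype.card L + 6) : (foldedDet (edgeGram F.edgeFinset)).coeff j =
      (openDet (edgeGram F.edgeFinset)).coeff j ↔ j = 0 ∨ j = 1 ∧ IsEmpty L := by
  refine ⟨fun h => ?_, hF.coeff_foldedDet_eq⟩
  by_contra! h0
  obtain rfl | h1 := eq_or_ne j 1
  · have := h0.2 rfl
    exact hF.coeff_one_foldedDet_lt.ne h
  · exact (hF.coeff_foldedDet_lt_of_two_le (by omega) hj).ne h

end

/-! ### Gluing the core to a core forest -/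

section Assembly
variable {L : Type*}

lemma portColumns_submatrix_one [DecidableEq L] (f : Core → Core) :
    portColumns L ((1 : Matrix Core Core ℝ).submatrix f id) =
      (1 : Matrix (Core ⊕ L) (Core ⊕ L) ℝ).submatrix (Sum.map f id) id := by
  ext (p | r) (q | s) <;> simp [portColumns, one_apply]

lemma det_portMatrix_edgeGram [Fintype L] [DecidableEq L] {E E' : Finset (Sym2 (Core ⊕ L))}
    {E₀ : Finset (Sym2 Core)} {R : Matrix Core Core ℝ}
    (hE : edgeGram E' = portCompress (edgeGram E) R)
    (hdisj : Disjoint E' (E₀.image (Sym2.map Sum.inl))) :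
    (portMatrix (edgeGram E) R ((X : ℝ[X]) • 1 + (edgeGram E₀).map C)).det =
      ((X : ℝ[X]) • 1 + (edgeGram (E' ∪ E₀.image (Sym2.map Sum.inl))).map C).det := by
  rw [edgeGram_union hdisj, edgeGram_image_inl, hE, portMatrix]
  congr 1
  ext (p | r) (q | s) <;> simp [one_apply, diagonal_apply]
  ring

/-- The vertex map that moves `v` and `w` to `u`. -/
def fold : Core ⊕ L → Core ⊕ L := Sum.map (Sum.map foldPort id) id

/-- The graph formed by `F` and the core edges. -/
def openGraph (F : SimpleGraph (Core ⊕ L)) : SimpleGraph (Core ⊕ L) :=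
  F ⊔ fromEdgeSet (Sym2.map Sum.inl '' coreEdges)

/-- The graph formed by `F`, after `v` and `w` have been moved to `u`, and the folded core edges. -/
def foldedGraph (F : SimpleGraph (Core ⊕ L)) : SimpleGraph (Core ⊕ L) :=
  F.map fold ⊔ fromEdgeSet (Sym2.map Sum.inl '' foldedCoreEdges)

lemma fold_eq_of_ne {x y : Core ⊕ L} (hxy : x ≠ y) (h : fold x = fold y) :
    fold x = .inl (.inl 0) := by
  have hcore : ∀ p q : Core, p ≠ q → Sum.map foldPort id p = Sum.map foldPort id q →
      Sum.map foldPort id p = (.inl 0 : Core) := by decide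
  rcases x with p | r <;> rcases y with q | s
  · exact congrArg Sum.inl
      (hcore p q (ne_of_apply_ne Sum.inl hxy) (Sum.inl_injective h))
  · cases h
  · cases h
  · exact absurd (congrArg Sum.inr (Sum.inr_injective h)) hxy

variable {F : SimpleGraph (Core ⊕ L)}

namespace IsCoreForest

lemma eq_of_fold_eq (hF : IsCoreForest F) {x y : Core ⊕ L} (h : F.Reachable x y)
    (hxy : fold x = fold y) : x = y := by
  have hport : ∀ i j : Fin 5, corePart i = corePart j → foldPort i = foldPort j → i = j := by
    decide
  obtain ((i | k) | r) := x <;> obtain ((j | l) | s) := y <;>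
    simp only [fold, Sum.map_inl, Sum.map_inr, id, Sum.inl.injEq, Sum.inr.injEq, reduceCtorEq]
      at hxy ⊢
  · exact hport i j (hF.corePart_eq h) hxy
  · exact hxy
  · exact hxy

lemma fold_ne_of_adj (hF : IsCoreForest F) {x y : Core ⊕ L} (h : F.Adj x y) : fold x ≠ fold y :=
  fun hxy => h.ne (hF.eq_of_fold_eq h.reachable hxy)

lemma injOn_map_fold (hF : IsCoreForest F) : Set.InjOn (Sym2.map fold) F.edgeSet := by
  have key {a b c d : Core ⊕ L} (hab : F.Adj a b) (hcd : F.Adj c d) (hac : fold a = fold c)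
      (hbd : fold b = fold d) : a = c := by
    by_contra hne
    by_cases hbd' : b = d
    · subst hbd'
      exact hne (hF.eq_of_fold_eq (hab.reachable.trans hcd.symm.reachable) hac)
    · exact hF.fold_ne_of_adj hab ((fold_eq_of_ne hne hac).trans (fold_eq_of_ne hbd' hbd).symm)
  intro e he e' he' h
  induction e with | h a b
  induction e' with | h c d
  rw [mem_edgeSet] at he he'
  rw [Sym2.map_mk, Sym2.map_mk, Sym2.eq_iff] at h
  obtain ⟨hac, hbd⟩ | ⟨had, hbc⟩ := h
  · rw [key he he' hac hbd, key he.symm he'.symm hbd hac]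
  · rw [key he he'.symm had hbc, key he.symm he' hbc had, Sym2.eq_swap]

lemma eq_far_of_adj (hF : IsCoreForest F) {p q : Core} (h : F.Adj (.inl p) (.inl q)) :
    s(p, q) = s(.inl 3, .inl 4) := by
  rcases p with i | k
  · rcases q with j | l
    · have hij := hF.corePart_eq h.reachable
      have hne : i ≠ j := by rintro rfl; exact h.ne rfl
      clear h
      decide +revert
    · exact (hF.isIsolated l _ h.symm).elim
  · exact (hF.isIsolated k _ h).elim

lemma eq_far_of_adj_map_fold (hF : IsCoreForest F) {p q : Core}
    (h : (F.map fold).Adj (.inl p) (.inl q)) : s(p, q) = s(.inl 3, .inl 4) := by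
  obtain ⟨-, x, y, hxy, hx, hy⟩ := h
  rcases x with p' | r
  · rcases y with q' | s
    · have h := congrArg (Sym2.map (Sum.map foldPort id)) (hF.eq_far_of_adj hxy)
      rw [← Sum.inl_injective hx, ← Sum.inl_injective hy]
      exact h
    · cases hy
  · cases hx

end IsCoreForest

variable [Fintype L]

section
variable [DecidableEq L]

lemma edgeFinset_openGraph [DecidableRel F.Adj] [DecidableRel (openGraph F).Adj] :
    (openGraph F).edgeFinset = F.edgeFinset ∪ coreEdges.image (Sym2.map Sum.inl) := by
  ext e
  rw [mem_edgeFinset, openGraph, edgeSet_sup, edgeSet_fromEdgeSet, Finset.mem_union,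
    mem_edgeFinset, Finset.mem_image]
  refine or_congr_right (and_iff_left_of_imp ?_)
  rintro ⟨e, he, rfl⟩
  revert e
  simp [coreEdges]

lemma IsCoreForest.edgeFinset_foldedGraph (hF : IsCoreForest F) [DecidableRel F.Adj]
    [DecidableRel (foldedGraph F).Adj] : (foldedGraph F).edgeFinset =
      F.edgeFinset.image (Sym2.map fold) ∪ foldedCoreEdges.image (Sym2.map Sum.inl) := by
  ext e
  rw [mem_edgeFinset, foldedGraph, edgeSet_sup, edgeSet_fromEdgeSet, Finset.mem_union,
    Finset.mem_image, Finset.mem_image]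
  refine or_congr ?_ (and_iff_left_of_imp ?_)
  · simp only [mem_edgeFinset]
    constructor
    · induction e with | h x y
      rintro ⟨-, a, b, hab, rfl, rfl⟩
      exact ⟨s(a, b), hab, rfl⟩
    · rintro ⟨e, he, rfl⟩
      induction e with | h a b
      exact map_adj_apply' he (hF.fold_ne_of_adj he)
  · rintro ⟨e, he, rfl⟩
    revert e
    simp [foldedCoreEdges]

lemma IsCoreForest.disjoint_coreEdges (hF : IsCoreForest F) [DecidableRel F.Adj] :
    Disjoint F.edgeFinset (coreEdges.image (Sym2.map Sum.inl)) := by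
  rw [Finset.disjoint_right]
  simp only [Finset.mem_image, mem_edgeFinset]
  rintro _ ⟨e, he, rfl⟩ h
  induction e with | h p q
  rw [hF.eq_far_of_adj h] at he
  exact absurd he (by decide)

lemma IsCoreForest.disjoint_foldedCoreEdges (hF : IsCoreForest F) [DecidableRel F.Adj] :
    Disjoint (F.edgeFinset.image (Sym2.map fold)) (foldedCoreEdges.image (Sym2.map Sum.inl)) := by
  rw [Finset.disjoint_left]
  simp only [Finset.mem_image, mem_edgeFinset]
  rintro _ ⟨e, he, rfl⟩ ⟨e', he', h⟩
  induction e with | h x y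
  induction e' with | h p q
  have hadj := map_adj_apply' he (hF.fold_ne_of_adj he)
  rw [← mem_edgeSet, ← Sym2.map_mk, ← h] at hadj
  rw [hF.eq_far_of_adj_map_fold hadj] at he'
  exact absurd he' (by decide)

lemma IsCoreForest.det_openGraph (hF : IsCoreForest F) [DecidableRel F.Adj]
    [DecidableRel (openGraph F).Adj] :
    ((X : ℝ[X]) • 1 + (edgeGram (openGraph F).edgeFinset).map C).det =
      openDet (edgeGram F.edgeFinset) := by
  have hone : portColumns L (1 : Matrix Core Core ℝ) = 1 := fromBlocks_one
  rw [openDet, det_portMatrix_edgeGram (E' := F.edgeFinset) ?_ hF.disjoint_coreEdges,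
    edgeFinset_openGraph]
  rw [portCompress, hone, transpose_one, Matrix.one_mul, Matrix.mul_one]

lemma IsCoreForest.det_foldedGraph (hF : IsCoreForest F) [DecidableRel F.Adj]
    [DecidableRel (foldedGraph F).Adj] :
    ((X : ℝ[X]) • 1 + (edgeGram (foldedGraph F).edgeFinset).map C).det =
      foldedDet (edgeGram F.edgeFinset) := by
  rw [foldedDet, det_portMatrix_edgeGram ?_ hF.disjoint_foldedCoreEdges,
    hF.edgeFinset_foldedGraph]
  rw [edgeGram_image _ (by simpa using hF.injOn_map_fold), portCompress, foldColumns,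
    portColumns_submatrix_one]
  rfl

end

lemma IsCoreForest.card_edgeFinset_foldedGraph (hF : IsCoreForest F)
    [DecidableRel (openGraph F).Adj] [DecidableRel (foldedGraph F).Adj] :
    (foldedGraph F).edgeFinset.card = (openGraph F).edgeFinset.card := by
  classical
  have hinl := Sym2.map.injective (Sum.inl_injective (α := Core) (β := L))
  rw [edgeFinset_openGraph, hF.edgeFinset_foldedGraph,
    Finset.card_union_of_disjoint hF.disjoint_coreEdges,
    Finset.card_union_of_disjoint hF.disjoint_foldedCoreEdges,
    Finset.card_image_of_injOn (by simpa using hF.injOn_map_fold),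
    Finset.card_image_of_injective _ hinl, Finset.card_image_of_injective _ hinl]
  rfl

theorem IsCoreForest.phi_foldedGraph_le (hF : IsCoreForest F) {i : ℕ}
    (hi : i ≤ Fintype.card (Core ⊕ L)) : phi (foldedGraph F) i ≤ phi (openGraph F) i := by
  classical
  rw [← Int.cast_le (R := ℝ), phi_eq_coeff_det _ hi, phi_eq_coeff_det _ hi, hF.det_openGraph,
    hF.det_foldedGraph]
  exact hF.coeff_foldedDet_le _

theorem IsCoreForest.phi_openGraph_eq_iff (hF : IsCoreForest F) {i : ℕ}
    (hi : i ≤ Fintype.card (Core ⊕ L)) : phi (openGraph F) i = phi (foldedGraph F) i ↔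
      i = 0 ∨ i = 1 ∨ i = Fintype.card (Core ⊕ L) ∨ (Fintype.card (Core ⊕ L) = 8 ∧ i = 7) := by
  classical
  obtain rfl | h0 := eq_or_ne i 0
  · exact iff_of_true (by rw [phi_zero, phi_zero]) (.inl rfl)
  obtain rfl | h1 := eq_or_ne i 1
  · exact iff_of_true (by rw [phi_one, phi_one, hF.card_edgeFinset_foldedGraph]) (.inr (.inl rfl))
  have hcard : Fintype.card (Core ⊕ L) = 8 + Fintype.card L := by simp
  rw [eq_comm, ← Int.cast_inj (α := ℝ), phi_eq_coeff_det _ hi, phi_eq_coeff_det _ hi,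
    hF.det_openGraph, hF.det_foldedGraph, hF.coeff_foldedDet_eq_iff (by omega),
    ← Fintype.card_eq_zero_iff]
  generalize Fintype.card (Core ⊕ L) = n at *
  omega

end Assembly

section Shorten
variable {V W L : Type*}

lemma mk_mem_image_mk {a b c : V} {T : Set V} :
    s(a, b) ∈ (fun x => s(c, x)) '' T ↔ a = c ∧ b ∈ T ∨ b = c ∧ a ∈ T := by
  simp only [Set.mem_image, Sym2.eq_iff]
  grind

lemma shortenCycle_adj {G : SimpleGraph V} {u v w v' w' a b : V} :
    (shortenCycle G u v w v' w').Adj a b ↔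
      G.Adj a b ∧ ¬(((a = v ∧ b = w ∨ a = w ∧ b = v) ∨
        (a = w ∧ G.Adj w b ∧ ¬(b = v ∨ b = w') ∨ b = w ∧ G.Adj w a ∧ ¬(a = v ∨ a = w'))) ∨
        (a = v ∧ G.Adj v b ∧ ¬(b = u ∨ b = w ∨ b = v') ∨
          b = v ∧ G.Adj v a ∧ ¬(a = u ∨ a = w ∨ a = v'))) ∨
      (((a = u ∧ b = w ∨ a = w ∧ b = u) ∨
        (a = u ∧ G.Adj w b ∧ ¬(b = v ∨ b = w') ∨ b = u ∧ G.Adj w a ∧ ¬(a = v ∨ a = w'))) ∨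
        (a = u ∧ G.Adj v b ∧ ¬(b = u ∨ b = w ∨ b = v') ∨
          b = u ∧ G.Adj v a ∧ ¬(a = u ∨ a = w ∨ a = v'))) ∧ a ≠ b := by
  simp only [shortenCycle, sup_adj, deleteEdges_adj, fromEdgeSet_adj, Set.mem_union,
    mk_mem_image_mk, Set.mem_singleton_iff, Sym2.eq_iff, Set.mem_sdiff, Set.mem_insert_iff,
    mem_neighborSet]

lemma shortenCycle_comap (e : W ≃ V) (G : SimpleGraph V) (u v w v' w' : W) :
    shortenCycle (G.comap e) u v w v' w' =
      (shortenCycle G (e u) (e v) (e w) (e v') (e w')).comap e := by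
  ext a b
  simp only [shortenCycle_adj, comap_adj, e.injective.eq_iff, ne_eq]

variable {F : SimpleGraph (Core ⊕ L)}

lemma fromEdgeSet_image_inl_adj_inl_inl {E : Finset (Sym2 Core)} {p q : Core} :
    (fromEdgeSet (Sym2.map (Sum.inl : Core → Core ⊕ L) '' E)).Adj (.inl p) (.inl q) ↔
      s(p, q) ∈ E ∧ p ≠ q := by
  rw [fromEdgeSet_adj, ← Sym2.map_mk, (Sym2.map.injective Sum.inl_injective).mem_set_image,
    Finset.mem_coe, Sum.inl_injective.ne_iff]

lemma not_fromEdgeSet_image_inl_adj_inr {E : Finset (Sym2 Core)} {x : Core ⊕ L} {s : L} :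
    ¬(fromEdgeSet (Sym2.map (Sum.inl : Core → Core ⊕ L) '' E)).Adj x (.inr s) := by
  rintro ⟨⟨e, -, he⟩, -⟩
  induction e
  simp at he

lemma map_fold_adj_inl_inr {p : Core} {s : L} : (F.map fold).Adj (.inl p) (.inr s) ↔
    ∃ q, Sum.map foldPort id q = p ∧ F.Adj (.inl q) (.inr s) := by
  simp [map_adj', fold, and_comm]

lemma map_fold_adj_inr_inr {r s : L} :
    (F.map fold).Adj (.inr r) (.inr s) ↔ F.Adj (.inr r) (.inr s) := by
  simpa [map_adj', fold] using fun h : F.Adj (.inr r) (.inr s) => h.ne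

lemma shortenCycle_openGraph_adj_inl_inr {p : Core} {s : L} :
    (shortenCycle (openGraph F) (.inl (.inl 0)) (.inl (.inl 1)) (.inl (.inl 2)) (.inl (.inr 1))
      (.inl (.inr 2))).Adj (.inl p) (.inr s) ↔ (foldedGraph F).Adj (.inl p) (.inr s) := by
  simp only [shortenCycle_adj, openGraph, foldedGraph, sup_adj, map_fold_adj_inl_inr,
    not_fromEdgeSet_image_inl_adj_inr, Sum.exists]
  rcases p with i | k
  · fin_cases i <;> simp [foldPort, Fin.exists_fin_succ]
    tauto
  · simp

namespace IsCoreForest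

lemma adj_inl_inl_iff (hF : IsCoreForest F) {p q : Core} : F.Adj (.inl p) (.inl q) ↔
    s(p, q) = s(.inl 3, .inl 4) ∧ F.Adj (.inl (.inl 3)) (.inl (.inl 4)) := by
  have hadj (h : s(p, q) = s(.inl 3, .inl 4)) :
      F.Adj (.inl p) (.inl q) ↔ F.Adj (.inl (.inl 3)) (.inl (.inl 4)) := by
    rw [← mem_edgeSet, ← mem_edgeSet, ← Sym2.map_mk, h, Sym2.map_mk]
  exact ⟨fun h => ⟨hF.eq_far_of_adj h, (hadj (hF.eq_far_of_adj h)).mp h⟩,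
    fun h => (hadj h.1).mpr h.2⟩

lemma map_fold_adj_inl_inl (hF : IsCoreForest F) {p q : Core} :
    (F.map fold).Adj (.inl p) (.inl q) ↔ F.Adj (.inl p) (.inl q) := by
  have hfix {p q : Core} (h : F.Adj (.inl p) (.inl q)) :
      (F.map fold).Adj (.inl p) (.inl q) := by
    have := map_adj_apply' h (hF.fold_ne_of_adj h)
    obtain ⟨rfl, rfl⟩ | ⟨rfl, rfl⟩ := Sym2.eq_iff.mp (hF.eq_far_of_adj h) <;> exact this
  refine ⟨?_, hfix⟩
  rintro ⟨-, p' | r, q' | s, h, hp, hq⟩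
  · have h' := hF.eq_far_of_adj h
    obtain ⟨rfl, rfl⟩ | ⟨rfl, rfl⟩ := Sym2.eq_iff.mp h' <;> cases hp <;> cases hq <;> exact h
  all_goals simp [fold] at hp hq

set_option maxRecDepth 100000 in
set_option synthInstance.maxSize 4000 in
set_option synthInstance.maxHeartbeats 400000 in
lemma shortenCycle_openGraph_adj_inl_inl (hF : IsCoreForest F) {p q : Core} :
    (shortenCycle (openGraph F) (.inl (.inl 0)) (.inl (.inl 1)) (.inl (.inl 2)) (.inl (.inr 1))
      (.inl (.inr 2))).Adj (.inl p) (.inl q) ↔ (foldedGraph F).Adj (.inl p) (.inl q) := by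
  obtain ⟨P, hP⟩ : ∃ P : Prop, ∀ p q : Core,
      F.Adj (.inl p) (.inl q) ↔ s(p, q) = s(.inl 3, .inl 4) ∧ P :=
    ⟨_, fun _ _ => hF.adj_inl_inl_iff⟩
  simp only [shortenCycle_adj, openGraph, foldedGraph, sup_adj, hF.map_fold_adj_inl_inl,
    fromEdgeSet_image_inl_adj_inl_inl, hP, Sum.inl.injEq, ne_eq]
  clear hP
  by_cases h : P <;> simp only [h, and_true, and_false] <;> clear h <;> decide +revert

theorem shortenCycle_openGraph (hF : IsCoreForest F) :
    shortenCycle (openGraph F) (.inl (.inl 0)) (.inl (.inl 1)) (.inl (.inl 2)) (.inl (.inr 1))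
      (.inl (.inr 2)) = foldedGraph F := by
  ext (p | r) (q | s)
  · exact hF.shortenCycle_openGraph_adj_inl_inl
  · exact shortenCycle_openGraph_adj_inl_inr
  · rw [adj_comm, shortenCycle_openGraph_adj_inl_inr, adj_comm]
  · simp only [shortenCycle_adj, openGraph, foldedGraph, sup_adj, map_fold_adj_inr_inr,
      not_fromEdgeSet_image_inl_adj_inr]
    simp

end IsCoreForest
end Shorten

/-! ### Cycles in unicyclic graphs -/

section Cycle
variable {V : Type*} {G : SimpleGraph V}

lemma isTree_deleteEdges [Fintype V] (hG : IsUnicyclic G) {a b : V} (hab : G.Adj a b)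
    (hr : (G.deleteEdges {s(a, b)}).Reachable a b) : (G.deleteEdges {s(a, b)}).IsTree := by
  rw [isTree_iff_connected_and_card]
  refine ⟨hG.1.connected_delete_edge_of_not_isBridge (by rwa [isBridge_iff, not_not]), ?_⟩
  rw [Nat.card_coe_set_eq, edgeSet_deleteEdges, Nat.card_eq_fintype_card, ← hG.2]
  exact Set.ncard_sdiff_singleton_add_one (G.mem_edgeSet.mpr hab)

lemma mem_edges_of_isCycle [Fintype V] (hG : IsUnicyclic G) {r : V} {c : G.Walk r r}
    (hc : c.IsCycle) {a b : V} (ha : a ∈ c.support) (hb : b ∈ c.support) (hab : G.Adj a b) :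
    s(a, b) ∈ c.edges := by
  classical
  by_contra h
  have hs : ∀ e ∈ c.edges, e ∉ ({s(a, b)} : Set (Sym2 V)) := by
    rintro e he rfl
    exact h he
  have hreach (x : V) (hx : x ∈ c.support) : (G.deleteEdges {s(a, b)}).Reachable r x :=
    ⟨(c.toDeleteEdges _ hs).takeUntil x (by simpa using hx)⟩
  exact (isTree_deleteEdges hG hab ((hreach a ha).symm.trans (hreach b hb))).isAcyclic _
    (hc.toDeleteEdges _ _ hs)

lemma exists_isPath_of_isCycle {r u v w : V} {c : G.Walk r r} (hc : c.IsCycle)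
    (huv : s(u, v) ∈ c.edges) (hvw : s(v, w) ∈ c.edges) (huw : u ≠ w) :
    ∃ p : G.Walk u w, p.IsPath ∧ v ∉ p.support ∧ p.length + 2 = c.length := by
  classical
  have hv : v ∈ c.support := c.fst_mem_support_of_mem_edges hvw
  have hmem {e : Sym2 V} (he : e ∈ c.edges) : e ∈ (c.rotate v hv).edges :=
    (c.rotate_edges v hv).mem_iff.mpr he
  have hlen := c.length_rotate v hv
  have hd := hc.rotate hv
  revert hd hlen
  rcases hdc : c.rotate v hv with - | @⟨_, a, _, hva, q⟩
  · exact fun _ h => absurd h Walk.not_isCycle_nil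
  intro hlen hd
  have hq : q.IsPath := ((Walk.cons_isCycle_iff _ _).mp hd).1
  have hnil : ¬q.Nil := Walk.not_nil_of_ne hva.ne'
  have hends {x : V} (hx : s(v, x) ∈ c.edges) : x = a ∨ x = q.penultimate := by
    have := hmem hx
    rw [hdc, Walk.edges_cons, List.mem_cons] at this
    exact this.imp Sym2.congr_right.mp hq.eq_penultimate_of_mem_edges
  have hpath : (q.dropLast.concat (q.adj_penultimate hnil)).IsPath := by
    rwa [Walk.concat_dropLast]
  obtain ⟨hpath, hvq⟩ := (Walk.concat_isPath_iff _).mp hpath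
  have hl : q.dropLast.length + 2 = c.length := by
    rw [← hlen, Walk.length_cons, ← Walk.length_dropLast_add_one hnil]
  rcases hends (Sym2.eq_swap ▸ huv) with rfl | rfl <;> rcases hends hvw with rfl | rfl
  · exact absurd rfl huw
  · exact ⟨q.dropLast, hpath, hvq, hl⟩
  · exact ⟨q.dropLast.reverse, hpath.reverse,
      by rwa [Walk.support_reverse, List.mem_reverse], by rwa [Walk.length_reverse]⟩
  · exact absurd rfl huw

lemma exists_inner_walk {u w : V} {p : G.Walk u w} (hp : p.IsPath) (hl : 3 ≤ p.length) :
    ∃ y z, G.Adj u y ∧ G.Adj w z ∧ y ≠ z ∧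
      ∃ m : G.Walk y z, m.support ⊆ p.support ∧ u ∉ m.support ∧ w ∉ m.support := by
  rcases p with - | @⟨_, y, _, huy, q⟩
  · simp at hl
  rw [Walk.length_cons] at hl
  obtain ⟨hq, huq⟩ := (Walk.cons_isPath_iff _ _).mp hp
  have hnil : ¬q.Nil := by
    rw [← Walk.length_eq_zero_iff]
    lia
  have hzw := q.adj_penultimate hnil
  have hsub : q.dropLast.support ⊆ q.support := by
    rw [← Walk.support_dropLast_concat hnil]
    exact List.subset_append_left _ _
  have hqw : (q.dropLast.concat hzw).IsPath := by rwa [Walk.concat_dropLast]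
  obtain ⟨-, hw⟩ := (Walk.concat_isPath_iff _).mp hqw
  refine ⟨y, q.penultimate, huy, hzw.symm, ?_, q.dropLast, ?_, fun h => huq (hsub h), hw⟩
  · intro hyz
    have := (hq.getVert_eq_start_iff (q.length.sub_le 1)).mp hyz.symm
    lia
  · exact fun x hx => List.mem_cons_of_mem _ (hsub hx)

lemma not_reachable_of_isAcyclic {T F : SimpleGraph V} (hT : T.IsAcyclic) {a b x : V}
    (hab : T.Adj a b) (hF : F ≤ T.deleteEdges {s(a, b)})
    (hbx : (T.deleteEdges {s(a, b)}).Reachable b x) : ¬F.Reachable a x := fun h =>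
  isAcyclic_iff_forall_adj_isBridge.mp hT hab ((h.mono hF).trans hbx.symm)

lemma exists_reachable_of_walk {F T : SimpleGraph V} {S : Set V}
    (hS : ∀ a b, T.Adj a b → ¬F.Adj a b → b ∈ S) {a b : V} (q : T.Walk a b) (ha : a ∈ S) :
    ∃ t ∈ S, F.Reachable b t := by
  suffices ∀ t ∈ S, F.Reachable a t → ∃ t ∈ S, F.Reachable b t from this a ha (.refl _)
  clear ha
  induction q with
  | nil => exact fun t ht h => ⟨t, ht, h⟩
  | @cons a d _ had _ ih =>
    intro t ht h
    by_cases hF : F.Adj a d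
    · exact ih t ht (hF.symm.reachable.trans h)
    · exact ih d (hS a d had hF) (.refl _)

end Cycle

/-! ### The core inside a unicyclic graph -/

section Embedding
variable {V : Type*} {G : SimpleGraph V} {κ : Core → V}

/-- `κ` places the core in `G`, with pendent edges at `u`, `v`, `w` and a walk from `y` to `z` that
closes the cycle. Injectivity of `κ` is a consequence. -/
structure IsCore (G : SimpleGraph V) (κ : Core → V) : Prop where
  mem_edgeSet : ∀ e ∈ coreEdges, e.map κ ∈ G.edgeSet
  eq_of_adj : ∀ {k : Fin 3} {x : V}, G.Adj (κ (.inr k)) x → x = κ (.inl (Fin.castAdd 2 k))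
  ne_uw : κ (.inl 0) ≠ κ (.inl 2)
  ne_yz : κ (.inl 3) ≠ κ (.inl 4)
  exists_walk : ∃ m : G.Walk (κ (.inl 3)) (κ (.inl 4)),
    ∀ k : Fin 3, κ (.inl (Fin.castAdd 2 k)) ∉ m.support

/-- The graph `G` without the edges in `E` of the core placed by `κ`. -/
def deleteCore (G : SimpleGraph V) (κ : Core → V) (E : Finset (Sym2 Core)) : SimpleGraph V :=
  G.deleteEdges (Sym2.map κ '' E)

lemma deleteCore_anti {E E' : Finset (Sym2 Core)} (hE : E ⊆ E') :
    deleteCore G κ E' ≤ deleteCore G κ E :=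
  deleteEdges_anti (Set.image_mono (Finset.coe_subset.mpr hE))

namespace IsCore

lemma adj (h : IsCore G κ) {p q : Core} (hpq : s(p, q) ∈ coreEdges) : G.Adj (κ p) (κ q) :=
  h.mem_edgeSet _ hpq

lemma reachable_far (h : IsCore G κ) :
    (deleteCore G κ coreEdges).Reachable (κ (.inl 3)) (κ (.inl 4)) := by
  obtain ⟨m, hm⟩ := h.exists_walk
  refine ⟨m.toDeleteEdges _ ?_⟩
  rintro _ he ⟨e, hcore, rfl⟩
  obtain ⟨k, hk⟩ : ∃ k : Fin 3, .inl (Fin.castAdd 2 k) ∈ e := by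
    have : ∀ e ∈ coreEdges, ∃ k : Fin 3, .inl (Fin.castAdd 2 k) ∈ e := by decide
    exact this e hcore
  exact hm k (m.mem_support_of_mem_edges he (Sym2.mem_map.mpr ⟨_, hk, rfl⟩))

lemma isIsolated (h : IsCore G κ) (k : Fin 3) :
    (deleteCore G κ coreEdges).IsIsolated (κ (.inr k)) := by
  intro x hx
  obtain ⟨hadj, hcore⟩ := deleteEdges_adj.mp hx
  refine hcore ⟨s(.inr k, .inl (Fin.castAdd 2 k)), ?_, by rw [h.eq_of_adj hadj, Sym2.map_mk]⟩
  clear * -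
  decide +revert

lemma not_reachable_pendant (h : IsCore G κ) {k : Fin 3} {x : V} (hx : x ≠ κ (.inr k)) :
    ¬(deleteCore G κ coreEdges).Reachable x (κ (.inr k)) :=
  not_reachable_of_neighborSet_right_eq_empty hx (h.isIsolated k).neighborSet_eq_empty

lemma inl_castAdd_ne_far (h : IsCore G κ) (k : Fin 3) :
    κ (.inl (Fin.castAdd 2 k)) ≠ κ (.inl 3) ∧ κ (.inl (Fin.castAdd 2 k)) ≠ κ (.inl 4) := by
  obtain ⟨m, hm⟩ := h.exists_walk
  exact ⟨fun e => hm k (by rw [e]; exact m.start_mem_support),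
    fun e => hm k (by rw [e]; exact m.end_mem_support)⟩

lemma injective_inl (h : IsCore G κ) : Function.Injective (κ ∘ Sum.inl) := by
  have huv : κ (.inl 0) ≠ κ (.inl 1) := (h.adj (by decide)).ne
  have hvw : κ (.inl 1) ≠ κ (.inl 2) := (h.adj (by decide)).ne
  have hfar := h.inl_castAdd_ne_far
  intro i j hij
  have h0 := hfar 0
  have h1 := hfar 1
  have h2 := hfar 2
  have := h.ne_uw
  have := h.ne_yz
  fin_cases i <;> fin_cases j <;> simp_all

lemma inl_ne_inr (h : IsCore G κ) (i : Fin 5) (k : Fin 3) : κ (.inl i) ≠ κ (.inr k) := by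
  intro hik
  have hcases : ∀ i : Fin 5, i = 3 ∨ i = 4 ∨
      ∃ p q : Fin 5, p ≠ q ∧ s(.inl i, .inl p) ∈ coreEdges ∧ s(.inl i, .inl q) ∈ coreEdges := by
    decide
  obtain rfl | rfl | ⟨p, q, hpq, hp, hq⟩ := hcases i
  · exact h.not_reachable_pendant (hik ▸ h.ne_yz.symm) (hik ▸ h.reachable_far.symm)
  · exact h.not_reachable_pendant (hik ▸ h.ne_yz) (hik ▸ h.reachable_far)
  · have hp' := h.adj hp
    have hq' := h.adj hq
    rw [hik] at hp' hq'
    exact hpq (h.injective_inl ((h.eq_of_adj hp').trans (h.eq_of_adj hq').symm))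

lemma injective (h : IsCore G κ) : Function.Injective κ := by
  rw [← Sum.elim_comp_inl_inr κ]
  refine h.injective_inl.sumElim (fun k l hkl => ?_) h.inl_ne_inr
  have hadj : G.Adj (κ (.inr k)) (κ (.inl (Fin.castAdd 2 k))) :=
    h.adj (by clear * -; decide +revert)
  rw [show κ (.inr k) = κ (.inr l) from hkl] at hadj
  exact Fin.castAdd_injective _ _ (h.injective_inl (h.eq_of_adj hadj))

lemma adj_deleteCore (h : IsCore G κ) {E : Finset (Sym2 Core)} {p q : Core}
    (hpq : s(p, q) ∈ coreEdges) (hE : s(p, q) ∉ E) : (deleteCore G κ E).Adj (κ p) (κ q) := by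
  rw [deleteCore, deleteEdges_adj, ← Sym2.map_mk,
    (Sym2.map.injective h.injective).mem_set_image]
  exact ⟨h.adj hpq, hE⟩

lemma isAcyclic_deleteCore [Fintype V] (hG : IsUnicyclic G) (h : IsCore G κ) :
    (deleteCore G κ {s(.inl 1, .inl 2)}).IsAcyclic := by
  have hvu : (deleteCore G κ {s(.inl 1, .inl 2)}).Adj (κ (.inl 1)) (κ (.inl 0)) :=
    h.adj_deleteCore (by decide) (by decide)
  have huy : (deleteCore G κ {s(.inl 1, .inl 2)}).Adj (κ (.inl 0)) (κ (.inl 3)) :=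
    h.adj_deleteCore (by decide) (by decide)
  have hyz := h.reachable_far.mono (deleteCore_anti (E := {s(.inl 1, .inl 2)}) (by decide))
  have hzw : (deleteCore G κ {s(.inl 1, .inl 2)}).Adj (κ (.inl 4)) (κ (.inl 2)) :=
    h.adj_deleteCore (by decide) (by decide)
  have hvw := hvu.reachable.trans (huy.reachable.trans (hyz.trans hzw.reachable))
  rw [deleteCore, Finset.coe_singleton, Set.image_singleton, Sym2.map_mk] at hvw ⊢
  exact (isTree_deleteEdges hG (h.adj (by decide)) hvw).isAcyclic

lemma not_reachable [Fintype V] (hG : IsUnicyclic G) (h : IsCore G κ) {p q : Core} {x : V}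
    (hpq : s(p, q) ∈ coreEdges) (hne : s(p, q) ≠ s(.inl 1, .inl 2))
    (hqx : (deleteCore G κ {s(.inl 1, .inl 2), s(p, q)}).Reachable (κ q) x) :
    ¬(deleteCore G κ coreEdges).Reachable (κ p) x := by
  have heq : (deleteCore G κ {s(.inl 1, .inl 2)}).deleteEdges {s(κ p, κ q)} =
      deleteCore G κ {s(.inl 1, .inl 2), s(p, q)} := by
    simp only [deleteCore, deleteEdges_deleteEdges, Finset.coe_pair, Finset.coe_singleton,
      Set.image_pair, Set.image_singleton, Set.singleton_union, Sym2.map_mk]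
  refine not_reachable_of_isAcyclic (h.isAcyclic_deleteCore hG)
    (h.adj_deleteCore hpq (by simpa using hne)) (heq ▸ deleteCore_anti ?_) (heq ▸ hqx)
  rw [Finset.insert_subset_iff, Finset.singleton_subset_iff]
  exact ⟨by decide, hpq⟩

lemma corePart_eq [Fintype V] (hG : IsUnicyclic G) (h : IsCore G κ) {i j : Fin 5}
    (hij : (deleteCore G κ coreEdges).Reachable (κ (.inl i)) (κ (.inl j))) :
    corePart i = corePart j := by
  wlog hlt : i < j generalizing i j
  · obtain rfl | hgt := (not_lt.mp hlt).eq_or_lt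
    · rfl
    · exact (this hij.symm hgt).symm
  have hadj {E : Finset (Sym2 Core)} {p q : Core} (hpq : s(p, q) ∈ coreEdges \ E) :
      (deleteCore G κ E).Reachable (κ p) (κ q) :=
    (h.adj_deleteCore (Finset.mem_sdiff.mp hpq).1 (Finset.mem_sdiff.mp hpq).2).reachable
  have hyz {E : Finset (Sym2 Core)} (hE : E ⊆ coreEdges) :=
    h.reachable_far.mono (deleteCore_anti hE)
  have hv {x : V} := h.not_reachable hG (p := .inl 1) (q := .inl 0) (x := x) (by decide) (by decide)
  have hu {x : V} := h.not_reachable hG (p := .inl 0) (q := .inl 3) (x := x) (by decide) (by decide)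
  have hw {x : V} := h.not_reachable hG (p := .inl 2) (q := .inl 4) (x := x) (by decide) (by decide)
  have hvu := hv (.refl _)
  have hvy := hv (hadj (q := .inl 3) (by decide))
  have hvw := hv ((hadj (by decide)).trans
    ((hyz (by decide)).trans (hadj (q := .inl 2) (by decide))))
  have huy := hu (.refl _)
  have huw := hu ((hyz (by decide)).trans (hadj (q := .inl 2) (by decide)))
  have hwy := hw (hyz (by decide)).symm
  have hz {x : V} (hx : (deleteCore G κ coreEdges).Reachable x (κ (.inl 4))) :=
    hx.trans h.reachable_far.symm
  clear hadj hyz hv hu hw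
  fin_cases i <;> fin_cases j <;> first
    | rfl
    | exact absurd hlt (by decide)
    | exact absurd hij ‹_›
    | exact absurd hij.symm ‹_›
    | exact absurd (hz hij) ‹_›

lemma exists_reachable [Fintype V] (hG : IsUnicyclic G) (h : IsCore G κ) {x : V}
    (hx : x ∉ Set.range κ) : ∃ i, (deleteCore G κ coreEdges).Reachable (κ (.inl i)) x := by
  obtain ⟨q⟩ := hG.1.preconnected (κ (.inl 0)) x
  have hcore (a b : V) (hab : G.Adj a b) (hab' : ¬(deleteCore G κ coreEdges).Adj a b) :
      b ∈ Set.range κ := by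
    rw [deleteCore, deleteEdges_adj, not_and_not_right] at hab'
    obtain ⟨e, -, he⟩ := hab' hab
    obtain ⟨p, -, hp⟩ := Sym2.mem_map.mp (he ▸ Sym2.mem_mk_right a b)
    exact ⟨p, hp⟩
  obtain ⟨-, ⟨i | k, rfl⟩, hr⟩ := exists_reachable_of_walk hcore q ⟨_, rfl⟩
  · exact ⟨i, hr.symm⟩
  · exact absurd hr (h.not_reachable_pendant fun hxk => hx ⟨_, hxk.symm⟩)

end IsCore
end Embedding

section Decomposition
variable {V : Type*} {G : SimpleGraph V} {κ : Core → V}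

lemma exists_coreEquiv (hκ : Function.Injective κ) :
    ∃ e : Core ⊕ ↥(Set.range κ)ᶜ ≃ V, ∀ p, e (.inl p) = κ p := by
  classical
  exact ⟨((Equiv.ofInjective κ hκ).sumCongr (.refl _)).trans (Equiv.Set.sumCompl _), fun _ => rfl⟩

namespace IsCore
variable {L : Type*} {e : Core ⊕ L ≃ V}

lemma comap_eq_openGraph (h : IsCore G κ) (he : ∀ p, e (.inl p) = κ p) :
    G.comap e = openGraph ((deleteCore G κ coreEdges).comap e) := by
  have hmem {a b : Core ⊕ L} : s(e a, e b) ∈ Sym2.map κ '' coreEdges ↔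
      s(a, b) ∈ Sym2.map Sum.inl '' (coreEdges : Set (Sym2 Core)) := by
    have hκ : Sym2.map κ = Sym2.map e ∘ Sym2.map Sum.inl := by
      rw [← Sym2.map_comp]
      exact congrArg Sym2.map (funext fun p => (he p).symm)
    rw [hκ, Set.image_comp, ← Sym2.map_mk, (Sym2.map.injective e.injective).mem_set_image]
  ext a b
  rw [openGraph, sup_adj, comap_adj, comap_adj, deleteCore, deleteEdges_adj, fromEdgeSet_adj, hmem]
  have hcore (hab : s(a, b) ∈ Sym2.map Sum.inl '' (coreEdges : Set (Sym2 Core))) :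
      G.Adj (e a) (e b) := by
    obtain ⟨d, hd, hd'⟩ := hmem.mpr hab
    exact G.mem_edgeSet.mp (hd' ▸ h.mem_edgeSet d hd)
  have hne (hab : G.Adj (e a) (e b)) : a ≠ b := fun h => hab.ne (congrArg e h)
  tauto

lemma isCoreForest_comap [Fintype V] (hG : IsUnicyclic G) (h : IsCore G κ)
    (he : ∀ p, e (.inl p) = κ p) : IsCoreForest ((deleteCore G κ coreEdges).comap e) := by
  have hreach {a b : Core ⊕ L} : ((deleteCore G κ coreEdges).comap e).Reachable a b ↔
      (deleteCore G κ coreEdges).Reachable (e a) (e b) :=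
    (Iso.comap e (deleteCore G κ coreEdges)).reachable_iff.symm
  refine ⟨?_, ?_, fun hij => ?_, fun k a => ?_, fun r => ?_⟩
  · exact (Iso.comap e _).isAcyclic_iff.mpr
      ((h.isAcyclic_deleteCore hG).anti (deleteCore_anti (by decide)))
  · rw [hreach, he, he]
    exact h.reachable_far
  · rw [hreach, he, he] at hij
    exact h.corePart_eq hG hij
  · rw [comap_adj, he]
    exact h.isIsolated k (e a)
  · have hr : e (.inr r) ∉ Set.range κ := by
      rintro ⟨p, hp⟩
      rw [← he, e.injective.eq_iff] at hp
      cases hp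
    obtain ⟨i, hi⟩ := h.exists_reachable hG hr
    exact ⟨i, by rwa [hreach, he]⟩

theorem exists_isCoreForest [Fintype V] (hG : IsUnicyclic G) (h : IsCore G κ) :
    ∃ (e : Core ⊕ ↥(Set.range κ)ᶜ ≃ V) (F : SimpleGraph (Core ⊕ ↥(Set.range κ)ᶜ)),
      IsCoreForest F ∧ G.comap e = openGraph F ∧
        (shortenCycle G (κ (.inl 0)) (κ (.inl 1)) (κ (.inl 2)) (κ (.inr 1)) (κ (.inr 2))).comap e =
          foldedGraph F := by
  obtain ⟨e, he⟩ := exists_coreEquiv h.injective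
  have hF := h.isCoreForest_comap hG he
  refine ⟨e, _, hF, h.comap_eq_openGraph he, ?_⟩
  rw [← hF.shortenCycle_openGraph, ← h.comap_eq_openGraph he, shortenCycle_comap]
  simp only [he]

end IsCore

lemma eq_of_isPendentEdgeAt [G.LocallyFinite] {x x' a : V} (h : IsPendentEdgeAt G x x')
    (ha : G.Adj x' a) : a = x := by
  obtain ⟨b, -, huniq⟩ := G.degree_eq_one_iff_existsUnique_adj.mp h.2
  exact (huniq a ha).trans (huniq x h.1.symm).symm

lemma exists_isCore [Fintype V] [G.LocallyFinite] (hG : IsUnicyclic G) {r : V} {c : G.Walk r r}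
    (hc : c.IsCycle) (hg : 5 ≤ c.length) {u v w u' v' w' : V} (hu : u ∈ c.support)
    (hv : v ∈ c.support) (hw : w ∈ c.support) (huv : G.Adj u v) (hvw : G.Adj v w) (huw : u ≠ w)
    (hu' : IsPendentEdgeAt G u u') (hv' : IsPendentEdgeAt G v v') (hw' : IsPendentEdgeAt G w w') :
    ∃ y z, IsCore G (Sum.elim ![u, v, w, y, z] ![u', v', w']) := by
  obtain ⟨p, hp, hvp, hl⟩ := exists_isPath_of_isCycle hc (mem_edges_of_isCycle hG hc hu hv huv)
    (mem_edges_of_isCycle hG hc hv hw hvw) huw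
  obtain ⟨y, z, huy, hwz, hyz, m, hm, hum, hwm⟩ := exists_inner_walk hp (by lia)
  refine ⟨y, z, ?_, fun {k x} hx => ?_, huw, hyz, m, fun k => ?_⟩
  · simpa [coreEdges] using ⟨huv, hvw, huy, hwz, hu'.1, hv'.1, hw'.1⟩
  · fin_cases k
    exacts [eq_of_isPendentEdgeAt hu' hx, eq_of_isPendentEdgeAt hv' hx,
      eq_of_isPendentEdgeAt hw' hx]
  · fin_cases k
    exacts [hum, fun h => hvp (hm h), hwm]

end Decomposition

end SignlessUnicyclic

open SignlessUnicyclic in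
theorem theorem2p8_general {V : Type*} [Fintype V] (G : SimpleGraph V) [DecidableRel G.Adj]
    (hG : IsUnicyclic G) {r : V} (c : G.Walk r r) (hc : c.IsCycle) (hg : 5 ≤ c.length)
    (u v w u' v' w' : V) (hu : u ∈ c.support) (hv : v ∈ c.support) (hw : w ∈ c.support)
    (huv : G.Adj u v) (hvw : G.Adj v w) (huw : u ≠ w)
    (hu' : IsPendentEdgeAt G u u') (hv' : IsPendentEdgeAt G v v') (hw' : IsPendentEdgeAt G w w') :
    ∀ i : ℕ, i ≤ Fintype.card V →
      phi (shortenCycle G u v w v' w') i ≤ phi G i ∧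
      (phi G i = phi (shortenCycle G u v w v' w') i ↔
        i = 0 ∨ i = 1 ∨ i = Fintype.card V ∨ (Fintype.card V = 8 ∧ i = 7)) := by
  classical
  obtain ⟨y, z, hcore⟩ := exists_isCore hG hc hg hu hv hw huv hvw huw hu' hv' hw'
  obtain ⟨e, F, hF, hopen, (hfold : (shortenCycle G u v w v' w').comap e = foldedGraph F)⟩ :=
    hcore.exists_isCoreForest hG
  intro i hi
  rw [← Fintype.card_congr e] at hi ⊢
  rw [← phi_comap e G, ← phi_comap e (shortenCycle G u v w v' w'), hopen, hfold]
  exact ⟨hF.phi_foldedGraph_le hi, hF.phi_openGraph_eq_iff hi⟩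

theorem theorem2p8 {V : Type*} [Fintype V] (G : SimpleGraph V) [DecidableRel G.Adj]
    (hn : 8 ≤ Fintype.card V) (hG : SignlessUnicyclic.IsUnicyclic G)
    {r : V} (c : G.Walk r r) (hc : c.IsCycle) (hg : 5 ≤ c.length)
    (hpaths : SignlessUnicyclic.OnlyShortPendentPaths c)
    (u v w u' v' w' : V)
    (hu : u ∈ c.support) (hv : v ∈ c.support) (hw : w ∈ c.support)
    (huv : G.Adj u v) (hvw : G.Adj v w) (huw : u ≠ w)
    (hu' : SignlessUnicyclic.IsPendentEdgeAt G u u')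
    (hv' : SignlessUnicyclic.IsPendentEdgeAt G v v')
    (hw' : SignlessUnicyclic.IsPendentEdgeAt G w w') :
    ∀ i : ℕ, i ≤ Fintype.card V →
      SignlessUnicyclic.phi (SignlessUnicyclic.shortenCycle G u v w v' w') i
          ≤ SignlessUnicyclic.phi G i ∧
      (SignlessUnicyclic.phi G i
          = SignlessUnicyclic.phi (SignlessUnicyclic.shortenCycle G u v w v' w') i ↔
        i = 0 ∨ i = 1 ∨ i = Fintype.card V ∨ (Fintype.card V = 8 ∧ i = 7)) := by
  exact theorem2p8_general G hG c hc hg u v w u' v' w' hu hv hw huv hvw huw hu' hv' hw'
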